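/- **Proposition (Change in Information Sensitivity).** The state is $\omega\in\{0,1\}$ and beliefs are identified with the probability $\mu\in[0,1]$ of state $1$. An adviser's posterior belief $s$ is distributed on $[0,1]$ with a strictly positive probability density $\tau$ (so the prior is $\mu_0=\int_0^1 s\,\tau(s)\,ds$). Fix $\alpha\in[0,1]$. With probability $\alpha$ the adviser is aligned and reports the message $m=s$; with probability $1-\alpha$ he is misaligned and sends a message in $[0,1]$ according to an arbitrary strategy $\beta$ mapping $s$ to distributions over messages. A decision problem consists of compact metric spaces $A$ (actions) and $\Theta$ (private types), a distribution $f(\cdot\mid\omega)$ of the type $\theta\in\Theta$ in each state, independent of $s$ (and of the message) conditional on $\omega$, and a bounded measurable utility $u(a,\omega,\theta)$ that is continuous in $a$. A private strategy is a measurable map $\hat\sigma:\Theta\to\Delta(A)$; $U(\hat\sigma,\mu)$ denotes its expected payoff when $\omega=1$ has probability $\mu$, $U(\mu)=\sup_{\hat\sigma}U(\hat\sigma,\mu)$ is the indirect utility function, and $\hat\sigma$ is Bayes-optimal for $\mu$ if $U(\hat\sigma,\mu)=U(\mu)$. A strategy $\sigma$ of the agent assigns, in a jointly measurable way, a private strategy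 $\hat\sigma(m)$ to every message $m$; it is optimal if it maximizes $$\alpha\,\mathbb E_{\mathrm{id},\sigma}[u(a,\omega,\theta)]+(1-\alpha)\inf_{\beta}\mathbb E_{\beta,\sigma}[u(a,\omega,\theta)].$$ It is a trust region strategy with trust region $T$, a compact subset of $[0,1]$, if $\hat\sigma(m)$ is Bayes-optimal for $m$ for every $m\in T$, and for every $m\notin T$, $\hat\sigma(m)$ is Bayes-optimal for some $P(m)\in\arg\max_{m'\in T}U(\hat\sigma(m'),m)$. Consider two decision problems, with the same $\tau$ and $\alpha$, whose indirect utility functions $U_1,U_2$ are strictly convex and twice differentiable on $[0,1]$. Suppose that $U_1$ is less information-sensitive at higher beliefs than $U_2$, i.e. $U_1''(\mu)/U_2''(\mu)$ is (weakly) decreasing in $\mu$ (understood as $U_1''(\mu')\,U_2''(\mu)\le U_1''(\mu)\,U_2''(\mu')$ for all $0\le\mu\le\mu'\le1$, so that zeros of the second derivatives are allowed). Let $T_1$ and $T_2$ be the trust regions of optimal trust region strategies in the two problems. Then $T_1$ is higher than $T_2$ in the strong set order: for all $x\in T_1$ and $y\in T_2$, $\max\{x,y\}\in T_1$ and $\min\{x,y\}\in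 T_2$. -/

import Mathlib

open MeasureTheory ProbabilityTheory Set

noncomputable section

namespace BinaryAdvice

/-- The agent's side of the model with state space `{0, 1}`: the conditional law `f ω` of her
private type in state `ω`, and a bounded ex-post utility `u a ω θ`, continuous in the action. -/
structure AgentProblem (A Θ : Type*) [TopologicalSpace A] [MeasurableSpace A]
    [MeasurableSpace Θ] where
  f : Fin 2 → ProbabilityMeasure Θ
  u : A → Fin 2 → Θ → ℝ
  measurable_u : ∀ ω, Measurable fun p : A × Θ => u p.1 ω p.2
  bounded_u : ∃ C : ℝ, ∀ a ω θ, |u a ω θ| ≤ C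
  continuous_u : ∀ ω θ, Continuous fun a => u a ω θ

/-- Private strategies `Θ → Δ(A)`. -/
abbrev PrivateStrategy (A Θ : Type*) [MeasurableSpace A] [MeasurableSpace Θ] :=
  {κ : Kernel Θ A // IsMarkovKernel κ}

/-- Strategies of the agent, `[0,1] × Θ → Δ(A)`; a message is a belief, identified with the
probability in `[0,1]` that it gives to state `1`. -/
abbrev Strategy (A Θ : Type*) [MeasurableSpace A] [MeasurableSpace Θ] :=
  {σ : Kernel (unitInterval × Θ) A // IsMarkovKernel σ}

/-- Strategies of the misaligned adviser, mapping beliefs to distributions over messages. -/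
abbrev AdviserStrategy := {β : Kernel unitInterval unitInterval // IsMarkovKernel β}

/-- The truthful strategy: report one's own belief. -/
def truthful : AdviserStrategy := ⟨Kernel.id, inferInstance⟩

/-- The private strategy that `σ` prescribes after message `m`. -/
def Strategy.after {A Θ : Type*} [MeasurableSpace A] [MeasurableSpace Θ]
    (σ : Strategy A Θ) (m : unitInterval) : PrivateStrategy A Θ :=
  haveI := σ.2
  ⟨Kernel.sectR σ.1 m, inferInstance⟩

/-- The law on `[0,1]` with density `τ` with respect to Lebesgue measure. -/
def posteriorLaw (τ : unitInterval → ℝ) : Measure unitInterval :=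
  volume.withDensity fun s => ENNReal.ofReal (τ s)

namespace AgentProblem

variable {A Θ : Type*} [TopologicalSpace A] [MeasurableSpace A] [MeasurableSpace Θ]

/-- The expected payoff `U(κ, μ)` of a private strategy `κ` when state `1` has probability `μ`. -/
def payoff (P : AgentProblem A Θ) (κ : PrivateStrategy A Θ) (μ : ℝ) : ℝ :=
  (1 - μ) * (∫ θ, ∫ a, P.u a 0 θ ∂(κ.1 θ) ∂(P.f 0 : Measure Θ)) +
    μ * (∫ θ, ∫ a, P.u a 1 θ ∂(κ.1 θ) ∂(P.f 1 : Measure Θ))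

/-- `κ` is Bayes-optimal for belief `μ`. -/
def IsBayesOptimal (P : AgentProblem A Θ) (κ : PrivateStrategy A Θ) (μ : ℝ) : Prop :=
  ∀ κ' : PrivateStrategy A Θ, P.payoff κ' μ ≤ P.payoff κ μ

/-- The indirect utility `U(μ)`, used for `μ ∈ [0,1]`. -/
def indirectUtility (P : AgentProblem A Θ) (μ : ℝ) : ℝ :=
  ⨆ κ : PrivateStrategy A Θ, P.payoff κ μ

/-- The expectation of `u` when the adviser's posterior has density `τ`, he reports according to
`β`, and the agent uses `σ`; given the posterior `s`, the state is `1` with probability `s`, and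
the type is independent of `s` and of the message conditionally on the state. -/
def expectedPayoff (P : AgentProblem A Θ) (τ : unitInterval → ℝ) (β : AdviserStrategy)
    (σ : Strategy A Θ) : ℝ :=
  ∫ s, ∫ m, P.payoff (σ.after m) (s : ℝ) ∂(β.1 s) ∂(posteriorLaw τ)

/-- The agent's worst-case payoff `U(σ)` at alignment probability `α`. -/
def guarantee (P : AgentProblem A Θ) (τ : unitInterval → ℝ) (α : ℝ) (σ : Strategy A Θ) : ℝ :=
  α * P.expectedPayoff τ truthful σ +
    (1 - α) * ⨅ β : AdviserStrategy, P.expectedPayoff τ β σ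

/-- `σ` attains the maximal worst-case payoff. -/
def IsOptimal (P : AgentProblem A Θ) (τ : unitInterval → ℝ) (α : ℝ) (σ : Strategy A Θ) : Prop :=
  ∀ σ' : Strategy A Θ, P.guarantee τ α σ' ≤ P.guarantee τ α σ

/-- `σ` is a trust region strategy with trust region `T`. -/
def IsTrustRegionStrategy (P : AgentProblem A Θ) (σ : Strategy A Θ) (T : Set unitInterval) : Prop :=
  IsCompact T ∧
  (∀ m ∈ T, P.IsBayesOptimal (σ.after m) m) ∧
  (∀ m ∉ T, ∃ p ∈ T, (∀ m' ∈ T, P.payoff (σ.after m') m ≤ P.payoff (σ.after p) m) ∧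
    P.IsBayesOptimal (σ.after m) p)

/-- `T` is the trust region of an optimal strategy. -/
def IsOptimalTrustRegion (P : AgentProblem A Θ) (τ : unitInterval → ℝ) (α : ℝ) (T : Set unitInterval) : Prop :=
  ∃ σ : Strategy A Θ, P.IsOptimal τ α σ ∧ P.IsTrustRegionStrategy σ T

end AgentProblem

/-- The first derivative on `[0,1]` (one-sided at the endpoints). -/
def deriv₁ (U : ℝ → ℝ) : ℝ → ℝ := derivWithin U (Icc 0 1)

/-- The second derivative on `[0,1]` (one-sided at the endpoints). -/
def deriv₂ (U : ℝ → ℝ) : ℝ → ℝ := derivWithin (deriv₁ U) (Icc 0 1)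

/-- `U` is twice differentiable on `[0,1]`. -/
def TwiceDifferentiable (U : ℝ → ℝ) : Prop :=
  DifferentiableOn ℝ U (Icc 0 1) ∧ DifferentiableOn ℝ (deriv₁ U) (Icc 0 1)

/-- `U₁'' / U₂''` is (weakly) decreasing on `[0,1]`. The inequality
`U₁''(y) / U₂''(y) ≤ U₁''(x) / U₂''(x)` is cleared of denominators, so that it keeps its meaning
where a second derivative vanishes; `lessInfoSensitive_iff` is the equivalence with the
monotonicity of the quotient wherever that quotient is defined throughout. -/
def LessInfoSensitive (U₁ U₂ : ℝ → ℝ) : Prop :=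
  ∀ x ∈ Icc (0 : ℝ) 1, ∀ y ∈ Icc (0 : ℝ) 1, x ≤ y →
    deriv₂ U₁ y * deriv₂ U₂ x ≤ deriv₂ U₁ x * deriv₂ U₂ y

theorem lessInfoSensitive_iff {U₁ U₂ : ℝ → ℝ} (h : ∀ x ∈ Icc (0 : ℝ) 1, 0 < deriv₂ U₂ x) :
    LessInfoSensitive U₁ U₂ ↔
      AntitoneOn (fun μ => deriv₂ U₁ μ / deriv₂ U₂ μ) (Icc (0 : ℝ) 1) := by
  constructor
  · intro H x hx y hy hxy
    exact (div_le_div_iff₀ (h y hy) (h x hx)).2 (H x hx y hy hxy)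
  · intro H x hx y hy hxy
    exact (div_le_div_iff₀ (h y hy) (h x hx)).1 (H hx hy hxy)

/-- `S` is higher than `T` in the strong set order. -/
def StrongSetGE {X : Type*} [LinearOrder X] (S T : Set X) : Prop :=
  ∀ x ∈ S, ∀ y ∈ T, max x y ∈ S ∧ min x y ∈ T

end BinaryAdvice

end

/-! The payoff of a private strategy is affine in the belief, so it is a line below the graph of U.
Bayes-optimality at p makes it the tangent at p, or, for p = 0 or 1, a line that on [0,1] lies below
that tangent. If a and b are the extreme points of the trust region, a misaligned adviser does his
worst by reporting one of them, which leaves at most the minimum of the two tangents. An aligned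
adviser is answered by at most the tangent at the point of [a, b] nearest to his belief. Both bounds
are approached by actual strategies, so an optimal trust region has ends that maximize `objective`,
and a gap inside it would be a strict loss.

The first-order condition for a is α E(a - X)⁺ = (1 - α) E[(X - a); X > c], where c is the abscissa
at which the tangents at a and b cross; the condition for b is its mirror image under x ↦ 1 - x.
Given τ and α, the function U enters only through c, and a higher c goes with lower a and b
(`IsDiffuse.le_of_firstOrder`).

The crossing c is the average of t over [a, b] with weights U''(t). It rises with a and b
(`IsStrictTangentPair.crossing_mono`), and it falls when weight moves to lower beliefs
(`LessInfoSensitive.crossing_le`). If c₁ > c₂, then a₁ ≤ a₂ and b₁ ≤ b₂, so c₁ is at most the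
crossing for U₁ at (a₂, b₂), hence at most c₂, which is absurd. So c₁ ≤ c₂, and the first-order
conditions order the ends. One-point intervals need α ≤ 1/2 and longer ones α > 1/2, so the two
kinds never meet; a one-point interval is the prior in both problems. -/

namespace BinaryAdvice

open Filter Topology

noncomputable section

/-! ### Tangent lines of a strictly convex function on the unit interval -/

/-- The line through `(p, U p)` with slope `D p`. -/
def tangent (U D : ℝ → ℝ) (p s : ℝ) : ℝ := U p + D p * (s - p)

/-- The abscissa at which the tangents at `p` and `q` cross. -/
def crossing (U D : ℝ → ℝ) (p q : ℝ) : ℝ := (q * D q - p * D p - (U q - U p)) / (D q - D p)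

/-- `U` is strictly convex on `[0,1]` with continuous derivative `D`: its graph lies strictly
above each of its tangents. -/
structure IsStrictTangentPair (U D : ℝ → ℝ) : Prop where
  lt : ∀ p ∈ Icc (0 : ℝ) 1, ∀ q ∈ Icc (0 : ℝ) 1, p ≠ q → tangent U D p q < U q
  contU : ContinuousOn U (Icc 0 1)
  contD : ContinuousOn D (Icc 0 1)

namespace IsStrictTangentPair

variable {U D : ℝ → ℝ}

theorem le (h : IsStrictTangentPair U D) {p q : ℝ} (hp : p ∈ Icc (0 : ℝ) 1)
    (hq : q ∈ Icc (0 : ℝ) 1) : tangent U D p q ≤ U q := by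
  rcases eq_or_ne p q with rfl | hne
  · simp [tangent]
  · exact (h.lt p hp q hq hne).le

theorem slope_lt (h : IsStrictTangentPair U D) {p q : ℝ} (hp : p ∈ Icc (0 : ℝ) 1)
    (hq : q ∈ Icc (0 : ℝ) 1) (hpq : p < q) : D p < D q := by
  have h1 := h.lt p hp q hq hpq.ne
  have h2 := h.lt q hq p hp hpq.ne'
  simp only [tangent] at h1 h2
  have : (D p - D q) * (q - p) < 0 := by linarith
  nlinarith

theorem slope_le (h : IsStrictTangentPair U D) {p q : ℝ} (hp : p ∈ Icc (0 : ℝ) 1)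
    (hq : q ∈ Icc (0 : ℝ) 1) (hpq : p ≤ q) : D p ≤ D q := by
  rcases hpq.eq_or_lt with rfl | hlt
  · exact le_rfl
  · exact (h.slope_lt hp hq hlt).le

theorem tangent_sub_tangent (h : IsStrictTangentPair U D) {p q : ℝ} (hp : p ∈ Icc (0 : ℝ) 1)
    (hq : q ∈ Icc (0 : ℝ) 1) (hpq : p < q) (s : ℝ) :
    tangent U D q s - tangent U D p s = (D q - D p) * (s - crossing U D p q) := by
  have : D q - D p ≠ 0 := (sub_pos.2 (h.slope_lt hp hq hpq)).ne'
  simp only [tangent, crossing]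
  field_simp
  ring

theorem lt_crossing (h : IsStrictTangentPair U D) {p q : ℝ} (hp : p ∈ Icc (0 : ℝ) 1)
    (hq : q ∈ Icc (0 : ℝ) 1) (hpq : p < q) : p < crossing U D p q := by
  have h2 := h.lt q hq p hp hpq.ne'
  rw [crossing, lt_div_iff₀ (sub_pos.2 (h.slope_lt hp hq hpq))]
  simp only [tangent] at h2
  linarith

theorem crossing_lt (h : IsStrictTangentPair U D) {p q : ℝ} (hp : p ∈ Icc (0 : ℝ) 1)
    (hq : q ∈ Icc (0 : ℝ) 1) (hpq : p < q) : crossing U D p q < q := by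
  have h2 := h.lt p hp q hq hpq.ne
  rw [crossing, div_lt_iff₀ (sub_pos.2 (h.slope_lt hp hq hpq))]
  simp only [tangent] at h2
  linarith

theorem tangent_le_tangent_iff (h : IsStrictTangentPair U D) {p q : ℝ} (hp : p ∈ Icc (0 : ℝ) 1)
    (hq : q ∈ Icc (0 : ℝ) 1) (hpq : p < q) {s : ℝ} :
    tangent U D p s ≤ tangent U D q s ↔ crossing U D p q ≤ s := by
  rw [← sub_nonneg, h.tangent_sub_tangent hp hq hpq,
    mul_nonneg_iff_of_pos_left (sub_pos.2 (h.slope_lt hp hq hpq)), sub_nonneg]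

/-- On the left of both, the tangent at the farther point is lower. -/
theorem tangent_anti (h : IsStrictTangentPair U D) {p q s : ℝ} (hp : p ∈ Icc (0 : ℝ) 1)
    (hq : q ∈ Icc (0 : ℝ) 1) (hpq : p ≤ q) (hs : s ≤ p) :
    tangent U D q s ≤ tangent U D p s := by
  rcases hpq.eq_or_lt with rfl | hlt
  · exact le_rfl
  by_contra hcon
  have := (h.tangent_le_tangent_iff hp hq hlt).1 (not_le.1 hcon).le
  linarith [h.lt_crossing hp hq hlt]

/-- On the right of both, the tangent at the farther point is lower. -/
theorem tangent_mono (h : IsStrictTangentPair U D) {p q s : ℝ} (hp : p ∈ Icc (0 : ℝ) 1)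
    (hq : q ∈ Icc (0 : ℝ) 1) (hpq : p ≤ q) (hs : q ≤ s) :
    tangent U D p s ≤ tangent U D q s := by
  rcases hpq.eq_or_lt with rfl | hlt
  · exact le_rfl
  exact (h.tangent_le_tangent_iff hp hq hlt).2 ((h.crossing_lt hp hq hlt).le.trans hs)

/-- A misaligned adviser gains nothing from interior points of [a, b]: at s left of p the tangent at
b is worse for the agent, at s right of p the tangent at a is. -/
theorem min_tangent_le (h : IsStrictTangentPair U D) {a b p s : ℝ} (ha : a ∈ Icc (0 : ℝ) 1)
    (hb : b ∈ Icc (0 : ℝ) 1) (hp : p ∈ Icc a b) :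
    min (tangent U D a s) (tangent U D b s) ≤ tangent U D p s := by
  have hp' : p ∈ Icc (0 : ℝ) 1 := ⟨ha.1.trans hp.1, hp.2.trans hb.2⟩
  rcases le_total s p with hs | hs
  · exact (min_le_right _ _).trans (h.tangent_anti hp' hb hp.2 hs)
  · exact (min_le_left _ _).trans (h.tangent_mono ha hp' hp.1 hs)

/-- Move one end at a time. Raising b lowers its tangent to the left of b, and raising a raises its
tangent to the right of the new a; either way the crossing moves right. -/
theorem crossing_mono (h : IsStrictTangentPair U D) {a b a' b' : ℝ} (ha : a ∈ Icc (0 : ℝ) 1)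
    (hb : b ∈ Icc (0 : ℝ) 1) (ha' : a' ∈ Icc (0 : ℝ) 1) (hb' : b' ∈ Icc (0 : ℝ) 1)
    (hab : a < b) (hab' : a' < b') (haa : a ≤ a') (hbb : b ≤ b') :
    crossing U D a b ≤ crossing U D a' b' := by
  have key1 : crossing U D a b ≤ crossing U D a b' := by
    rw [← h.tangent_le_tangent_iff ha hb hab]
    have hlt := hab.trans_le hbb
    by_contra hcon
    have hcon := not_le.1 hcon
    have h1 : crossing U D a b' < crossing U D a b := by
      by_contra h2
      exact absurd ((h.tangent_le_tangent_iff ha hb hab).2 (not_lt.1 h2)) (not_le.2 hcon)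
    have h3 := h.tangent_anti (s := crossing U D a b') hb hb' hbb
      (h1.le.trans (h.crossing_lt ha hb hab).le)
    have h4 := (h.tangent_le_tangent_iff ha hb' hlt).2 le_rfl
    linarith
  have key2 : crossing U D a b' ≤ crossing U D a' b' := by
    have hlt := hab.trans_le hbb
    rw [← h.tangent_le_tangent_iff ha hb' hlt]
    have h4 := (h.tangent_le_tangent_iff ha' hb' hab').2 le_rfl
    exact (h.tangent_mono ha ha' haa (h.lt_crossing ha' hb' hab').le).trans h4
  exact key1.trans key2

theorem continuousOn_crossing (h : IsStrictTangentPair U D) {b : ℝ} (hb : b ∈ Icc (0 : ℝ) 1) :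
    ContinuousOn (fun a => crossing U D a b) (Ico 0 b) := by
  have hsub : Ico 0 b ⊆ Icc (0 : ℝ) 1 := fun x hx => ⟨hx.1, hx.2.le.trans hb.2⟩
  have hU := h.contU.mono hsub
  have hD := h.contD.mono hsub
  refine ContinuousOn.div (by fun_prop) (by fun_prop) fun x hx => ?_
  exact (sub_pos.2 (h.slope_lt (hsub hx) hb hx.2)).ne'

/-- Reflection of the unit interval. -/
theorem reflect (h : IsStrictTangentPair U D) :
    IsStrictTangentPair (fun x => U (1 - x)) (fun x => -D (1 - x)) := by
  have hm : MapsTo (fun x : ℝ => 1 - x) (Icc 0 1) (Icc 0 1) := fun x hx =>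
    ⟨by linarith [hx.2], by linarith [hx.1]⟩
  refine ⟨fun p hp q hq hpq => ?_, h.contU.comp (by fun_prop) hm,
    (h.contD.comp (by fun_prop) hm).neg⟩
  have := h.lt (1 - p) (hm hp) (1 - q) (hm hq) (by simpa using hpq)
  simp only [tangent] at this ⊢
  linarith

end IsStrictTangentPair

theorem tangent_reflect (U D : ℝ → ℝ) (p s : ℝ) :
    tangent (fun x => U (1 - x)) (fun x => -D (1 - x)) (1 - p) (1 - s) = tangent U D p s := by
  simp only [tangent, sub_sub_cancel]
  ring

theorem crossing_reflect (U D : ℝ → ℝ) (p q : ℝ) (hne : D q - D p ≠ 0) :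
    crossing (fun x => U (1 - x)) (fun x => -D (1 - x)) (1 - q) (1 - p)
      = 1 - crossing U D p q := by
  simp only [crossing, sub_sub_cancel]
  rw [neg_sub_neg, eq_sub_iff_add_eq, ← add_div, div_eq_one_iff_eq hne]
  ring

/-! ### The payoff of a trusted interval -/

/-- The truthful adviser's message is replaced by the nearest point of `[a, b]`. -/
def trustedPayoff (U D : ℝ → ℝ) (a b s : ℝ) : ℝ := tangent U D (max a (min b s)) s

namespace IsStrictTangentPair

variable {U D : ℝ → ℝ}

theorem continuous_trustedPayoff (h : IsStrictTangentPair U D) {a b : ℝ}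
    (ha : a ∈ Icc (0 : ℝ) 1) (hb : b ∈ Icc (0 : ℝ) 1) : Continuous (trustedPayoff U D a b) := by
  have hm : ∀ s : ℝ, max a (min b s) ∈ Icc (0 : ℝ) 1 := fun s =>
    ⟨le_max_of_le_left ha.1, max_le ha.2 ((min_le_left _ _).trans hb.2)⟩
  have hc : Continuous fun s : ℝ => max a (min b s) := by fun_prop
  have h1 := h.contU.comp_continuous hc hm
  have h2 := h.contD.comp_continuous hc hm
  exact h1.add (h2.mul (continuous_id.sub hc))

/-- Only beliefs below the larger of a and a' are answered differently. The bound comes from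
comparing the old tangent with U at a', or at s when a' ≤ s ≤ a. -/
theorem trustedPayoff_sub_ge (h : IsStrictTangentPair U D) {a a' b s : ℝ}
    (ha : a ∈ Icc (0 : ℝ) 1) (ha' : a' ∈ Icc (0 : ℝ) 1)
    (hab : a ≤ b) (hab' : a' ≤ b) (hs : s ∈ Icc (0 : ℝ) 1) :
    -((D a' - D a) * max (a' - s) 0) ≤ trustedPayoff U D a' b s - trustedPayoff U D a b s := by
  unfold trustedPayoff
  rcases le_total a a' with haa | haa
  · rcases le_total a' s with has | has
    · rw [max_eq_right (le_min hab' has), max_eq_right (le_min hab (haa.trans has)),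
        max_eq_right (by linarith)]
      simp
    · rw [min_eq_right (has.trans hab'), max_eq_left has, max_eq_left (by linarith)]
      have hr : max a s ∈ Icc (0 : ℝ) 1 := ⟨le_max_of_le_left ha.1, max_le ha.2 hs.2⟩
      have h1 := h.le hr ha'
      have h2 := h.slope_le ha hr (le_max_left _ _)
      simp only [tangent] at h1 ⊢
      nlinarith
  · rcases le_total a s with has | has
    · rw [max_eq_right (le_min hab' (haa.trans has)), max_eq_right (le_min hab has),
        max_eq_right (by linarith)]
      simp
    · rw [min_eq_right (has.trans hab), max_eq_left has]
      rcases le_total a' s with has' | has'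
      · rw [max_eq_right has', max_eq_right (by linarith : a' - s ≤ 0)]
        have := h.le ha hs
        simp only [tangent] at this ⊢
        linarith
      · rw [max_eq_left has', max_eq_left (by linarith)]
        have := h.le ha ha'
        simp only [tangent] at this ⊢
        linarith

/-- Right of the new crossing the minimum is the tangent at a', and the old tangent lies below U at
a'. Left of it the minimum is the tangent at b, which already bounded the old minimum. -/
theorem min_tangent_sub_ge (h : IsStrictTangentPair U D) {a a' b s : ℝ}
    (ha : a ∈ Icc (0 : ℝ) 1) (ha' : a' ∈ Icc (0 : ℝ) 1) (hb : b ∈ Icc (0 : ℝ) 1)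
    (hab' : a' < b) :
    (D a' - D a) * (if crossing U D a' b < s then s - a' else 0) ≤
      min (tangent U D a' s) (tangent U D b s) - min (tangent U D a s) (tangent U D b s) := by
  split_ifs with hc
  · rw [min_eq_left ((h.tangent_le_tangent_iff ha' hb hab').2 hc.le)]
    have h1 := min_le_left (tangent U D a s) (tangent U D b s)
    have := h.le ha ha'
    simp only [tangent] at this h1 ⊢
    linarith
  · have h2 : tangent U D b s ≤ tangent U D a' s := by
      rw [← sub_nonpos, h.tangent_sub_tangent ha' hb hab']
      exact mul_nonpos_of_nonneg_of_nonpos (sub_pos.2 (h.slope_lt ha' hb hab')).le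
        (sub_nonpos.2 (not_lt.1 hc))
    rw [min_eq_right h2, mul_zero, sub_nonneg]
    exact min_le_right _ _

end IsStrictTangentPair

theorem trustedPayoff_reflect (U D : ℝ → ℝ) {a b : ℝ} (hab : a ≤ b) (s : ℝ) :
    trustedPayoff (fun x => U (1 - x)) (fun x => -D (1 - x)) (1 - b) (1 - a) (1 - s)
      = trustedPayoff U D a b s := by
  have : max (1 - b) (min (1 - a) (1 - s)) = 1 - max a (min b s) := by
    rcases le_total a s with h1 | h1 <;> rcases le_total b s with h2 | h2
    · rw [min_eq_right (by linarith), max_eq_left (by linarith), min_eq_left h2, max_eq_right hab]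
    · rw [min_eq_right (by linarith), max_eq_right (by linarith), min_eq_right h2, max_eq_right h1]
    · rw [min_eq_left (by linarith), max_eq_right (by linarith), min_eq_left h2, max_eq_left]
      linarith
    · rw [min_eq_left (by linarith), max_eq_right (by linarith), min_eq_right h2, max_eq_left h1]
  rw [trustedPayoff, this, tangent_reflect, trustedPayoff]

/-! ### First-order conditions for the trusted interval -/

section Objective

variable {Ω : Type*} [MeasurableSpace Ω]

/-- An atomless random belief with full support in `[0,1]`. -/
structure IsDiffuse (X : Ω → ℝ) (ν : Measure Ω) : Prop where
  measurable : Measurable X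
  mem : ∀ ω, X ω ∈ Icc (0 : ℝ) 1
  ne : ∀ c, ∀ᵐ ω ∂ν, X ω ≠ c
  pos : ∀ x ∈ Icc (0 : ℝ) 1, ∀ y ∈ Icc (0 : ℝ) 1, x < y → 0 < ν (X ⁻¹' Ioo x y)

/-- The expected size of `a - X` on the event that it is positive. -/
def shortfall (X : Ω → ℝ) (ν : Measure Ω) (a : ℝ) : ℝ := ∫ ω, max (a - X ω) 0 ∂ν

/-- The expectation of `X - a` on the event `c < X`. -/
def tailExcess (X : Ω → ℝ) (ν : Measure Ω) (a c : ℝ) : ℝ :=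
  ∫ ω, (if c < X ω then X ω - a else 0) ∂ν

/-- The payoff guaranteed by the trust region `[a, b]`. -/
def objective (U D : ℝ → ℝ) (X : Ω → ℝ) (ν : Measure Ω) (α a b : ℝ) : ℝ :=
  α * ∫ ω, trustedPayoff U D a b (X ω) ∂ν +
    (1 - α) * ∫ ω, min (tangent U D a (X ω)) (tangent U D b (X ω)) ∂ν

/-- `[a, b]` maximizes the guaranteed payoff. -/
structure IsBestInterval (U D : ℝ → ℝ) (X : Ω → ℝ) (ν : Measure Ω) (α a b : ℝ) : Prop where
  nonneg : 0 ≤ a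
  le : a ≤ b
  le_one : b ≤ 1
  objective_le : ∀ a' b', 0 ≤ a' → a' ≤ b' → b' ≤ 1 → objective U D X ν α a' b' ≤ objective U D X ν α a b

theorem continuous_tangent (U D : ℝ → ℝ) (p : ℝ) : Continuous (tangent U D p) := by
  unfold tangent
  fun_prop

namespace IsDiffuse

variable {X : Ω → ℝ} {ν : Measure Ω}

theorem reflect (h : IsDiffuse X ν) : IsDiffuse (fun ω => 1 - X ω) ν := by
  refine ⟨h.measurable.const_sub 1, fun ω => ⟨by linarith [(h.mem ω).2], by linarith [(h.mem ω).1]⟩,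
    fun c => ?_, fun x hx y hy hxy => ?_⟩
  · filter_upwards [h.ne (1 - c)] with ω hω hc
    exact hω (by linarith)
  · have := h.pos (1 - y) ⟨by linarith [hy.2], by linarith [hy.1]⟩ (1 - x)
      ⟨by linarith [hx.2], by linarith [hx.1]⟩ (by linarith)
    convert this using 2
    ext ω
    simp only [mem_preimage, mem_Ioo]
    constructor <;> rintro ⟨h1, h2⟩ <;> constructor <;> linarith

theorem measurable_tail (h : IsDiffuse X ν) (a c : ℝ) :
    Measurable fun ω => if c < X ω then X ω - a else 0 :=
  Measurable.ite (measurableSet_lt measurable_const h.measurable)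
    (h.measurable.sub_const a) measurable_const

/-- A pointwise inequality that is strict on an interval integrates to a strict inequality. -/
theorem integral_lt_integral (h : IsDiffuse X ν) {f g : Ω → ℝ} (hf : Integrable f ν)
    (hg : Integrable g ν) (hle : ∀ ω, f ω ≤ g ω) {x y : ℝ} (hx : x ∈ Icc (0 : ℝ) 1)
    (hy : y ∈ Icc (0 : ℝ) 1) (hxy : x < y) (hlt : ∀ ω, X ω ∈ Ioo x y → f ω < g ω) :
    ∫ ω, f ω ∂ν < ∫ ω, g ω ∂ν := by
  have : 0 < ∫ ω, (g ω - f ω) ∂ν := by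
    rw [integral_pos_iff_support_of_nonneg (fun ω => sub_nonneg.2 (hle ω)) (hg.sub hf)]
    refine (h.pos x hx y hy hxy).trans_le (measure_mono fun ω hω => ?_)
    exact (sub_pos.2 (hlt ω hω)).ne'
  rw [integral_sub hg hf] at this
  linarith

variable [IsProbabilityMeasure ν]

theorem integrable_comp (h : IsDiffuse X ν) {g : ℝ → ℝ} (hg : Continuous g) :
    Integrable (fun ω => g (X ω)) ν := by
  obtain ⟨C, hC⟩ := isCompact_Icc.exists_bound_of_continuousOn (s := Icc (0 : ℝ) 1) hg.continuousOn
  exact Integrable.of_bound (hg.measurable.comp h.measurable).aestronglyMeasurable C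
    (.of_forall fun ω => hC _ (h.mem ω))

theorem integrable_tail (h : IsDiffuse X ν) (a c : ℝ) :
    Integrable (fun ω => if c < X ω then X ω - a else 0) ν := by
  refine Integrable.of_bound (h.measurable_tail a c).aestronglyMeasurable (1 + |a|)
    (.of_forall fun ω => ?_)
  have := h.mem ω
  split_ifs
  · rw [Real.norm_eq_abs, abs_le]
    constructor <;> linarith [this.1, this.2, neg_abs_le a, le_abs_self a]
  · simp only [norm_zero]; positivity

theorem integrable_shortfall (h : IsDiffuse X ν) (a : ℝ) :
    Integrable (fun ω => max (a - X ω) 0) ν :=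
  h.integrable_comp (g := fun s => max (a - s) 0) (by fun_prop)

theorem integrable_min_tangent (h : IsDiffuse X ν) (U D : ℝ → ℝ) (a b : ℝ) :
    Integrable (fun ω => min (tangent U D a (X ω)) (tangent U D b (X ω))) ν :=
  h.integrable_comp (g := fun s => min (tangent U D a s) (tangent U D b s))
    ((continuous_tangent U D a).min (continuous_tangent U D b))

theorem continuous_shortfall (h : IsDiffuse X ν) : Continuous (shortfall X ν) := by
  have : LipschitzWith 1 (shortfall X ν) := by
    refine LipschitzWith.of_dist_le_mul fun x y => ?_
    rw [NNReal.coe_one, one_mul, Real.dist_eq, Real.dist_eq, shortfall, shortfall,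
      ← integral_sub (h.integrable_shortfall x) (h.integrable_shortfall y)]
    refine (norm_integral_le_of_norm_le_const (μ := ν)
      (f := fun ω => max (x - X ω) 0 - max (y - X ω) 0) (C := |x - y|)
      (.of_forall fun ω => ?_)).trans ?_
    · rw [Real.norm_eq_abs]
      refine (abs_max_sub_max_le_abs _ _ _).trans_eq ?_
      ring_nf
    · simp
  exact this.continuous

/-- Dominated convergence: the integrand converges off the event X = c, which is null because X has
no atoms. -/
theorem tendsto_tailExcess (h : IsDiffuse X ν) {ι : Type*} {l : Filter ι} [l.IsCountablyGenerated]
    {f g : ι → ℝ} {a c : ℝ} (hf : Tendsto f l (𝓝 a)) (hg : Tendsto g l (𝓝 c)) :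
    Tendsto (fun i => tailExcess X ν (f i) (g i)) l (𝓝 (tailExcess X ν a c)) := by
  refine tendsto_integral_filter_of_dominated_convergence (fun _ => 2 + |a|) ?_ ?_
    (integrable_const _) ?_
  · exact .of_forall fun i => (h.measurable_tail _ _).aestronglyMeasurable
  · filter_upwards [hf.eventually (Metric.ball_mem_nhds a one_pos)] with i hi
    refine .of_forall fun ω => ?_
    have hX := h.mem ω
    have hi : |f i - a| < 1 := hi
    rw [abs_lt] at hi
    split_ifs
    · rw [Real.norm_eq_abs, abs_le]
      constructor <;> linarith [hX.1, hX.2, neg_abs_le a, le_abs_self a]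
    · simp only [norm_zero]; positivity
  · filter_upwards [h.ne c] with ω hω
    rcases lt_or_gt_of_ne hω with hlt | hgt
    · rw [if_neg hlt.not_gt]
      refine tendsto_const_nhds.congr' ?_
      filter_upwards [hg.eventually (lt_mem_nhds hlt)] with i hi
      rw [if_neg (lt_asymm hi)]
    · rw [if_pos hgt]
      refine (tendsto_const_nhds.sub hf).congr' ?_
      filter_upwards [hg.eventually (gt_mem_nhds hgt)] with i hi
      rw [if_pos hi]

theorem shortfall_lt (h : IsDiffuse X ν) {a a' : ℝ} (ha : 0 ≤ a) (haa : a < a') (ha' : a' ≤ 1) :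
    shortfall X ν a < shortfall X ν a' := by
  refine h.integral_lt_integral (h.integrable_shortfall a) (h.integrable_shortfall a')
    (fun ω => max_le_max (by linarith) le_rfl) ⟨ha, haa.le.trans ha'⟩
    ⟨ha.trans haa.le, ha'⟩ haa fun ω hω => ?_
  rw [max_eq_right (by linarith [hω.1]), max_eq_left (by linarith [hω.2])]
  linarith [hω.2]

theorem tailExcess_anti (h : IsDiffuse X ν) {a c a' c' : ℝ} (hac : a ≤ c) (haa : a ≤ a')
    (hcc : c ≤ c') : tailExcess X ν a' c' ≤ tailExcess X ν a c := by
  refine integral_mono (h.integrable_tail a' c') (h.integrable_tail a c) fun ω => ?_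
  dsimp only
  split_ifs <;> linarith

/-- A higher crossing point goes with a lower interval. -/
theorem le_of_firstOrder (h : IsDiffuse X ν) {α : ℝ} (hα : 0 < α) (hα1 : α ≤ 1) {a c a' c' : ℝ}
    (ha : 0 ≤ a) (ha' : a' ≤ 1) (hac : a ≤ c) (hcc : c ≤ c')
    (hfoc : α * shortfall X ν a = (1 - α) * tailExcess X ν a c)
    (hfoc' : α * shortfall X ν a' = (1 - α) * tailExcess X ν a' c') : a' ≤ a := by
  by_contra hcon
  have hcon := not_le.1 hcon
  have h1 := mul_lt_mul_of_pos_left (h.shortfall_lt ha hcon ha') hα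
  have h2 := mul_le_mul_of_nonneg_left (h.tailExcess_anti hac hcon.le hcc) (sub_nonneg.2 hα1)
  linarith

end IsDiffuse

variable {U D : ℝ → ℝ} {X : Ω → ℝ} {ν : Measure Ω}

theorem objective_reflect {α a b : ℝ} (hab : a ≤ b) :
    objective (fun x => U (1 - x)) (fun x => -D (1 - x)) (fun ω => 1 - X ω) ν α (1 - b) (1 - a)
      = objective U D X ν α a b := by
  simp only [objective, trustedPayoff_reflect U D hab, tangent_reflect]
  simp only [min_comm]

theorem IsBestInterval.reflect {α a b : ℝ} (h : IsBestInterval U D X ν α a b) :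
    IsBestInterval (fun x => U (1 - x)) (fun x => -D (1 - x)) (fun ω => 1 - X ω) ν α
      (1 - b) (1 - a) := by
  refine ⟨by linarith [h.le_one], by linarith [h.le], by linarith [h.nonneg],
    fun a' b' h1 h2 h3 => ?_⟩
  have := h.objective_le (1 - b') (1 - a') (by linarith) (by linarith) (by linarith)
  rw [← objective_reflect (by linarith), ← objective_reflect h.le] at this
  simpa only [sub_sub_cancel] using this

namespace IsBestInterval

variable [IsProbabilityMeasure ν] {α a b : ℝ}

/-- The deviation to [a', b] is finite, and both bounds on its gain share the factor D a' - D a.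
Cancelling this factor, whose sign depends on the side of a', and letting a' → a gives the
first-order condition without differentiating D. -/
theorem marginal_nonpos (h : IsBestInterval U D X ν α a b) (hU : IsStrictTangentPair U D)
    (hX : IsDiffuse X ν) (hα : 0 ≤ α) (hα1 : α ≤ 1) {a' : ℝ} (ha' : 0 ≤ a') (hab' : a' < b) :
    (D a' - D a) * ((1 - α) * tailExcess X ν a' (crossing U D a' b) - α * shortfall X ν a') ≤ 0 := by
  have ma : a ∈ Icc (0 : ℝ) 1 := ⟨h.nonneg, h.le.trans h.le_one⟩
  have mb : b ∈ Icc (0 : ℝ) 1 := ⟨h.nonneg.trans h.le, h.le_one⟩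
  have ma' : a' ∈ Icc (0 : ℝ) 1 := ⟨ha', hab'.le.trans h.le_one⟩
  have i1 := hX.integrable_comp (hU.continuous_trustedPayoff ma' mb)
  have i2 := hX.integrable_comp (hU.continuous_trustedPayoff ma mb)
  have i3 := hX.integrable_min_tangent U D a' b
  have i4 := hX.integrable_min_tangent U D a b
  have e1 : -((D a' - D a) * shortfall X ν a') ≤ ∫ ω, trustedPayoff U D a' b (X ω) ∂ν -
      ∫ ω, trustedPayoff U D a b (X ω) ∂ν := by
    rw [shortfall, ← integral_const_mul, ← integral_neg, ← integral_sub i1 i2]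
    exact integral_mono ((hX.integrable_shortfall a').const_mul _).neg (i1.sub i2) fun ω =>
      hU.trustedPayoff_sub_ge ma ma' h.le hab'.le (hX.mem ω)
  have e2 : (D a' - D a) * tailExcess X ν a' (crossing U D a' b) ≤
      ∫ ω, min (tangent U D a' (X ω)) (tangent U D b (X ω)) ∂ν -
      ∫ ω, min (tangent U D a (X ω)) (tangent U D b (X ω)) ∂ν := by
    rw [tailExcess, ← integral_const_mul, ← integral_sub i3 i4]
    exact integral_mono ((hX.integrable_tail a' _).const_mul _) (i3.sub i4) fun ω =>
      hU.min_tangent_sub_ge ma ma' mb hab'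
  have e3 := h.objective_le a' b ha' hab'.le h.le_one
  simp only [objective] at e3
  have e1' := mul_le_mul_of_nonneg_left e1 hα
  have e2' := mul_le_mul_of_nonneg_left e2 (sub_nonneg.2 hα1)
  linarith

/-- The crossing enters as a limit c so that a = b is covered, where `crossing` itself would be 0 /
0. -/
theorem shortfall_le (h : IsBestInterval U D X ν α a b) (hU : IsStrictTangentPair U D)
    (hX : IsDiffuse X ν) (hα : 0 ≤ α) (hα1 : α ≤ 1) (ha : 0 < a) {c : ℝ}
    (hc : Tendsto (fun x => crossing U D x b) (𝓝[<] a) (𝓝 c)) :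
    α * shortfall X ν a ≤ (1 - α) * tailExcess X ν a c := by
  have ha1 : a ≤ 1 := h.le.trans h.le_one
  have hid : Tendsto (fun x : ℝ => x) (𝓝[<] a) (𝓝 a) := tendsto_nhdsWithin_of_tendsto_nhds tendsto_id
  refine le_of_tendsto_of_tendsto
    (((hX.continuous_shortfall.tendsto a).comp hid).const_mul α)
    ((hX.tendsto_tailExcess hid hc).const_mul (1 - α)) ?_
  filter_upwards [Ioo_mem_nhdsLT ha] with x hx
  have h1 := h.marginal_nonpos hU hX hα hα1 hx.1.le (hx.2.trans_le h.le)
  have h2 := hU.slope_lt ⟨hx.1.le, hx.2.le.trans ha1⟩ ⟨ha.le, ha1⟩ hx.2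
  simp only [Function.comp]
  by_contra hcon
  have := mul_pos (sub_pos.2 h2) (sub_pos.2 (not_le.1 hcon))
  linarith

theorem le_shortfall (h : IsBestInterval U D X ν α a b) (hU : IsStrictTangentPair U D)
    (hX : IsDiffuse X ν) (hα : 0 ≤ α) (hα1 : α ≤ 1) (hab : a < b) {c : ℝ}
    (hc : Tendsto (fun x => crossing U D x b) (𝓝[>] a) (𝓝 c)) :
    (1 - α) * tailExcess X ν a c ≤ α * shortfall X ν a := by
  have hid : Tendsto (fun x : ℝ => x) (𝓝[>] a) (𝓝 a) := tendsto_nhdsWithin_of_tendsto_nhds tendsto_id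
  refine le_of_tendsto_of_tendsto
    ((hX.tendsto_tailExcess hid hc).const_mul (1 - α))
    (((hX.continuous_shortfall.tendsto a).comp hid).const_mul α) ?_
  filter_upwards [Ioo_mem_nhdsGT hab] with x hx
  have hx0 := h.nonneg.trans hx.1.le
  have h1 := h.marginal_nonpos hU hX hα hα1 hx0 hx.2
  have h2 := hU.slope_lt ⟨h.nonneg, h.le.trans h.le_one⟩ ⟨hx0, hx.2.le.trans h.le_one⟩ hx.1
  simp only [Function.comp]
  by_contra hcon
  have := mul_pos (sub_pos.2 h2) (sub_pos.2 (not_le.1 hcon))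
  linarith

/-- The first-order condition at the lower end of the best interval. -/
theorem firstOrder (h : IsBestInterval U D X ν α a b) (hU : IsStrictTangentPair U D)
    (hX : IsDiffuse X ν) (hα : 0 ≤ α) (hα1 : α ≤ 1) (hab : a < b) :
    α * shortfall X ν a = (1 - α) * tailExcess X ν a (crossing U D a b) := by
  have mb : b ∈ Icc (0 : ℝ) 1 := ⟨h.nonneg.trans h.le, h.le_one⟩
  have ma : a ∈ Icc (0 : ℝ) 1 := ⟨h.nonneg, h.le.trans h.le_one⟩
  have hcont := hU.continuousOn_crossing mb a ⟨h.nonneg, hab⟩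
  have hright : Tendsto (fun x => crossing U D x b) (𝓝[>] a) (𝓝 (crossing U D a b)) := by
    refine hcont.tendsto.mono_left (nhdsWithin_le_of_mem ?_)
    filter_upwards [Ioo_mem_nhdsGT hab] with x hx using ⟨h.nonneg.trans hx.1.le, hx.2⟩
  refine le_antisymm ?_ (h.le_shortfall hU hX hα hα1 hab hright)
  -- At a = 0 there is no deviation to the left, but the shortfall vanishes there because X ≥ 0.
  rcases h.nonneg.eq_or_lt with h0 | h0
  · have h1 : shortfall X ν a = 0 := by
      rw [shortfall]
      refine integral_eq_zero_of_ae (.of_forall fun ω => ?_)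
      simpa [← h0] using (hX.mem ω).1
    rw [h1, mul_zero]
    refine mul_nonneg (sub_nonneg.2 hα1) (integral_nonneg fun ω => ?_)
    have := hU.lt_crossing ma mb hab
    dsimp only [Pi.zero_apply]
    split_ifs <;> linarith
  · refine h.shortfall_le hU hX hα hα1 h0 (hcont.tendsto.mono_left (nhdsWithin_le_of_mem ?_))
    filter_upwards [Ioo_mem_nhdsLT h0] with x hx using ⟨hx.1.le, hx.2.trans hab⟩

/-- The first-order condition at the upper end of the best interval. -/
theorem firstOrder_upper (h : IsBestInterval U D X ν α a b) (hU : IsStrictTangentPair U D)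
    (hX : IsDiffuse X ν) (hα : 0 ≤ α) (hα1 : α ≤ 1) (hab : a < b) :
    α * shortfall (fun ω => 1 - X ω) ν (1 - b)
      = (1 - α) * tailExcess (fun ω => 1 - X ω) ν (1 - b) (1 - crossing U D a b) := by
  have hne := (sub_pos.2 (hU.slope_lt ⟨h.nonneg, h.le.trans h.le_one⟩
    ⟨h.nonneg.trans h.le, h.le_one⟩ hab)).ne'
  have := h.reflect.firstOrder hU.reflect hX.reflect hα hα1 (by linarith)
  rwa [crossing_reflect U D a b hne] at this

/-! ### One-point intervals and the threshold 1/2 -/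

theorem objective_self (U D : ℝ → ℝ) (hX : IsDiffuse X ν) (p : ℝ) :
    objective U D X ν α p p = tangent U D p (∫ ω, X ω ∂ν) := by
  have iX : Integrable X ν := hX.integrable_comp continuous_id
  have h1 : ∀ s, trustedPayoff U D p p s = tangent U D p s := fun s => by simp [trustedPayoff]
  have h2 : ∫ ω, tangent U D p (X ω) ∂ν = tangent U D p (∫ ω, X ω ∂ν) := by
    simp only [tangent]
    have iXp : Integrable (fun ω => X ω - p) ν := iX.sub (integrable_const _)
    rw [integral_add (integrable_const _) (iXp.const_mul _),
      integral_const_mul, integral_sub iX (integrable_const _)]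
    simp
  simp only [objective, h1, min_self, h2]
  ring

theorem _root_.BinaryAdvice.IsDiffuse.mean_mem (hX : IsDiffuse X ν) :
    ∫ ω, X ω ∂ν ∈ Ioo (0 : ℝ) 1 := by
  have iX : Integrable X ν := hX.integrable_comp continuous_id
  have h0 := hX.integral_lt_integral (integrable_zero Ω ℝ ν) iX (fun ω => (hX.mem ω).1)
    (left_mem_Icc.2 zero_le_one) (right_mem_Icc.2 zero_le_one) one_pos fun ω hω => hω.1
  have h1 := hX.integral_lt_integral iX (integrable_const (1 : ℝ)) (fun ω => (hX.mem ω).2)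
    (left_mem_Icc.2 zero_le_one) (right_mem_Icc.2 zero_le_one) one_pos fun ω hω => hω.2
  exact ⟨by simpa using h0, by simpa using h1⟩

/-- A degenerate best interval is the prior. -/
theorem eq_mean (h : IsBestInterval U D X ν α a a) (hU : IsStrictTangentPair U D)
    (hX : IsDiffuse X ν) : a = ∫ ω, X ω ∂ν := by
  by_contra hne
  have hm := Ioo_subset_Icc_self hX.mean_mem
  have h1 := h.objective_le _ _ hm.1 le_rfl hm.2
  rw [objective_self U D hX, objective_self U D hX] at h1
  have h2 := hU.lt a ⟨h.nonneg, h.le_one⟩ _ hm hne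
  have h3 : tangent U D (∫ ω, X ω ∂ν) (∫ ω, X ω ∂ν) = U (∫ ω, X ω ∂ν) := by simp [tangent]
  linarith

/-- As x increases to a, the crossing of the tangents at x and a tends to a. Since a is the mean,
the tail excess at a equals the shortfall, which is positive, and the one-sided condition becomes α
≤ 1 - α. -/
theorem le_half_of_degenerate (h : IsBestInterval U D X ν α a a) (hU : IsStrictTangentPair U D)
    (hX : IsDiffuse X ν) (hα : 0 ≤ α) (hα1 : α ≤ 1) : α ≤ 1 / 2 := by
  have hm := hX.mean_mem
  have iX : Integrable X ν := hX.integrable_comp continuous_id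
  rw [← h.eq_mean hU hX] at hm
  have ma : a ∈ Icc (0 : ℝ) 1 := Ioo_subset_Icc_self hm
  have hid : Tendsto (fun x : ℝ => x) (𝓝[<] a) (𝓝 a) := tendsto_nhdsWithin_of_tendsto_nhds tendsto_id
  have hc : Tendsto (fun x => crossing U D x a) (𝓝[<] a) (𝓝 a) := by
    refine tendsto_of_tendsto_of_tendsto_of_le_of_le' hid tendsto_const_nhds ?_ ?_ <;>
      filter_upwards [Ioo_mem_nhdsLT hm.1] with x hx
    · exact (hU.lt_crossing ⟨hx.1.le, hx.2.le.trans hm.2.le⟩ ma hx.2).le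
    · exact (hU.crossing_lt ⟨hx.1.le, hx.2.le.trans hm.2.le⟩ ma hx.2).le
  have h1 := h.shortfall_le hU hX hα hα1 hm.1 hc
  have h2 : tailExcess X ν a a - shortfall X ν a = 0 := by
    rw [tailExcess, shortfall, ← integral_sub (hX.integrable_tail a a) (hX.integrable_shortfall a)]
    have : ∀ ω, (if a < X ω then X ω - a else 0) - max (a - X ω) 0 = X ω - a := fun ω => by
      split_ifs with hlt
      · rw [max_eq_right (by linarith)]; ring
      · rw [max_eq_left (by linarith)]; ring
    simp only [this]
    rw [integral_sub iX (integrable_const _), ← h.eq_mean hU hX]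
    simp
  have h3 := hX.shortfall_lt le_rfl hm.1 hm.2.le
  have h4 : 0 ≤ shortfall X ν 0 := integral_nonneg fun ω => le_max_right _ _
  have h5 : tailExcess X ν a a = shortfall X ν a := by linarith
  rw [h5] at h1
  have := le_of_mul_le_mul_right h1 (h4.trans_lt h3)
  linarith

/-- Add the two first-order conditions. As a < c < b, each tail excess dominates the shortfall at
the opposite end, once strictly, so α must exceed 1 - α. -/
theorem half_lt_of_nondegenerate (h : IsBestInterval U D X ν α a b) (hU : IsStrictTangentPair U D)
    (hX : IsDiffuse X ν) (hα : 0 ≤ α) (hα1 : α ≤ 1) (hab : a < b) : 1 / 2 < α := by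
  have mb : b ∈ Icc (0 : ℝ) 1 := ⟨h.nonneg.trans h.le, h.le_one⟩
  have ma : a ∈ Icc (0 : ℝ) 1 := ⟨h.nonneg, h.le.trans h.le_one⟩
  have f1 := h.firstOrder hU hX hα hα1 hab
  have f2 := h.firstOrder_upper hU hX hα hα1 hab
  have hac := hU.lt_crossing ma mb hab
  have hcb := hU.crossing_lt ma mb hab
  set c := crossing U D a b
  have mc : c ∈ Icc (0 : ℝ) 1 := ⟨ma.1.trans hac.le, hcb.le.trans mb.2⟩
  have g1 : shortfall (fun ω => 1 - X ω) ν (1 - b) < tailExcess X ν a c := by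
    refine hX.integral_lt_integral (hX.reflect.integrable_shortfall _) (hX.integrable_tail _ _)
      (fun ω => ?_) mc mb hcb fun ω hω => ?_
    · split_ifs
      · exact max_le (by linarith) (by linarith)
      · exact max_le (by linarith) le_rfl
    · rw [if_pos hω.1, max_eq_right (by linarith [hω.2])]
      linarith [hω.1]
  have g2 : shortfall X ν a ≤ tailExcess (fun ω => 1 - X ω) ν (1 - b) (1 - c) := by
    refine integral_mono (hX.integrable_shortfall _) (hX.reflect.integrable_tail _ _) fun ω => ?_
    dsimp only
    split_ifs
    · exact max_le (by linarith) (by linarith)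
    · exact max_le (by linarith) le_rfl
  have g0 : 0 ≤ shortfall X ν a := integral_nonneg fun ω => le_max_right _ _
  have g0' : 0 ≤ shortfall (fun ω => 1 - X ω) ν (1 - b) :=
    integral_nonneg fun ω => le_max_right _ _
  by_contra hcon
  have hcon := not_lt.1 hcon
  nlinarith

end IsBestInterval

end Objective

/-! ### Information sensitivity and the crossing point -/

theorem isStrictTangentPair_of_strictConvexOn {U : ℝ → ℝ} (hconv : StrictConvexOn ℝ (Icc 0 1) U)
    (hdiff : TwiceDifferentiable U) : IsStrictTangentPair U (deriv₁ U) := by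
  refine ⟨fun p hp q hq hpq => ?_, hdiff.1.continuousOn, hdiff.2.continuousOn⟩
  unfold tangent
  rcases lt_or_gt_of_ne hpq with hlt | hgt
  · have := hconv.derivWithin_lt_slope hp hq hlt (hdiff.1 p hp)
    rw [slope_def_field, lt_div_iff₀ (sub_pos.2 hlt)] at this
    unfold deriv₁
    linarith
  · have := hconv.slope_lt_derivWithin hq hp hgt (hdiff.1 p hp)
    rw [slope_def_field, div_lt_iff₀ (sub_pos.2 hgt)] at this
    unfold deriv₁
    linarith

theorem monotoneOn_Icc_of_hasDerivWithinAt {f f' : ℝ → ℝ} {a b : ℝ} (ha : 0 ≤ a) (hb : b ≤ 1)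
    (hf : ∀ x ∈ Icc a b, HasDerivWithinAt f (f' x) (Icc 0 1) x) (hf' : ∀ x ∈ Icc a b, 0 ≤ f' x) :
    MonotoneOn f (Icc a b) := by
  have hsub : Icc a b ⊆ Icc (0 : ℝ) 1 := Icc_subset_Icc ha hb
  refine monotoneOn_of_hasDerivWithinAt_nonneg (f' := f') (convex_Icc a b)
    (fun x hx => ((hf x hx).mono hsub).continuousWithinAt)
    (fun x hx => (hf x (interior_subset hx)).mono (interior_subset.trans hsub))
    fun x hx => hf' x (interior_subset hx)

/-- The marginal utility of `U₁` rises relatively faster on the left. -/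
theorem LessInfoSensitive.slope_diff_mul_le {U₁ U₂ : ℝ → ℝ} (h : LessInfoSensitive U₁ U₂)
    (h₁ : TwiceDifferentiable U₁) (h₂ : TwiceDifferentiable U₂) {a t b : ℝ} (ha : 0 ≤ a)
    (hat : a ≤ t) (htb : t ≤ b) (hb : b ≤ 1) :
    (deriv₁ U₁ b - deriv₁ U₁ t) * (deriv₁ U₂ t - deriv₁ U₂ a) ≤
      (deriv₁ U₁ t - deriv₁ U₁ a) * (deriv₁ U₂ b - deriv₁ U₂ t) := by
  have d₁ : ∀ x ∈ Icc (0 : ℝ) 1, HasDerivWithinAt (deriv₁ U₁) (deriv₂ U₁ x) (Icc 0 1) x :=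
    fun x hx => (h₁.2 x hx).hasDerivWithinAt
  have d₂ : ∀ x ∈ Icc (0 : ℝ) 1, HasDerivWithinAt (deriv₁ U₂) (deriv₂ U₂ x) (Icc 0 1) x :=
    fun x hx => (h₂.2 x hx).hasDerivWithinAt
  -- The pointwise inequality is integrated over y in [t, b], then over x in [a, t]; monotonicity of
  -- auxiliary functions stands in for both integrals.
  have step : ∀ x ∈ Icc a t, deriv₂ U₂ x * (deriv₁ U₁ b - deriv₁ U₁ t) ≤
      deriv₂ U₁ x * (deriv₁ U₂ b - deriv₁ U₂ t) := by
    intro x hx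
    have := monotoneOn_Icc_of_hasDerivWithinAt (a := t) (b := b)
      (f := fun y => deriv₂ U₁ x * deriv₁ U₂ y - deriv₂ U₂ x * deriv₁ U₁ y)
      (f' := fun y => deriv₂ U₁ x * deriv₂ U₂ y - deriv₂ U₂ x * deriv₂ U₁ y)
      (ha.trans hat) hb
      (fun y hy => ((d₂ y ⟨(ha.trans hat).trans hy.1, hy.2.trans hb⟩).const_mul _).sub
        ((d₁ y ⟨(ha.trans hat).trans hy.1, hy.2.trans hb⟩).const_mul _))
      (fun y hy => by
        have := h x ⟨ha.trans hx.1, hx.2.trans (htb.trans hb)⟩ y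
          ⟨(ha.trans hat).trans hy.1, hy.2.trans hb⟩ (hx.2.trans hy.1)
        linarith)
      (left_mem_Icc.2 htb) (right_mem_Icc.2 htb) htb
    dsimp only at this
    linarith
  have := monotoneOn_Icc_of_hasDerivWithinAt (a := a) (b := t)
    (f := fun x => (deriv₁ U₂ b - deriv₁ U₂ t) * deriv₁ U₁ x -
      (deriv₁ U₁ b - deriv₁ U₁ t) * deriv₁ U₂ x)
    (f' := fun x => (deriv₁ U₂ b - deriv₁ U₂ t) * deriv₂ U₁ x -
      (deriv₁ U₁ b - deriv₁ U₁ t) * deriv₂ U₂ x)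
    ha (htb.trans hb)
    (fun x hx => ((d₁ x ⟨ha.trans hx.1, hx.2.trans (htb.trans hb)⟩).const_mul _).sub
      ((d₂ x ⟨ha.trans hx.1, hx.2.trans (htb.trans hb)⟩).const_mul _))
    (fun x hx => by linarith [step x hx])
    (left_mem_Icc.2 hat) (right_mem_Icc.2 hat) hat
  dsimp only at this
  linarith

/-- The distance b - c is the integral over [a, b] of (D t - D a) / (D b - D a), and by
`slope_diff_mul_le` this normalized slope is pointwise larger for U₁. -/
theorem LessInfoSensitive.crossing_le {U₁ U₂ : ℝ → ℝ} (h : LessInfoSensitive U₁ U₂)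
    (h₁ : TwiceDifferentiable U₁) (h₂ : TwiceDifferentiable U₂)
    (hU₁ : IsStrictTangentPair U₁ (deriv₁ U₁)) (hU₂ : IsStrictTangentPair U₂ (deriv₁ U₂))
    {a b : ℝ} (ha : 0 ≤ a) (hab : a < b) (hb : b ≤ 1) :
    crossing U₁ (deriv₁ U₁) a b ≤ crossing U₂ (deriv₁ U₂) a b := by
  have ma : a ∈ Icc (0 : ℝ) 1 := ⟨ha, hab.le.trans hb⟩
  have mb : b ∈ Icc (0 : ℝ) 1 := ⟨ha.trans hab.le, hb⟩
  have p₁ := sub_pos.2 (hU₁.slope_lt ma mb hab)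
  have p₂ := sub_pos.2 (hU₂.slope_lt ma mb hab)
  have key := monotoneOn_Icc_of_hasDerivWithinAt (a := a) (b := b)
    (f := fun t => (deriv₁ U₂ b - deriv₁ U₂ a) * (U₁ t - deriv₁ U₁ a * t) -
      (deriv₁ U₁ b - deriv₁ U₁ a) * (U₂ t - deriv₁ U₂ a * t))
    (f' := fun t => (deriv₁ U₂ b - deriv₁ U₂ a) * (deriv₁ U₁ t - deriv₁ U₁ a * 1) -
      (deriv₁ U₁ b - deriv₁ U₁ a) * (deriv₁ U₂ t - deriv₁ U₂ a * 1))
    ha hb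
    (fun t ht => by
      have mt : t ∈ Icc (0 : ℝ) 1 := ⟨ha.trans ht.1, ht.2.trans hb⟩
      exact (((h₁.1 t mt).hasDerivWithinAt.sub ((hasDerivWithinAt_id t _).const_mul _)).const_mul
        _).sub (((h₂.1 t mt).hasDerivWithinAt.sub
          ((hasDerivWithinAt_id t _).const_mul _)).const_mul _))
    (fun t ht => by linarith [h.slope_diff_mul_le h₁ h₂ ha ht.1 ht.2 hb])
    (left_mem_Icc.2 hab.le) (right_mem_Icc.2 hab.le) hab.le
  dsimp only at key
  rw [crossing, crossing, div_le_div_iff₀ p₁ p₂]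
  linarith

/-! ### Comparison of the best intervals -/

section Comparison

variable {Ω : Type*} [MeasurableSpace Ω] {X : Ω → ℝ} {ν : Measure Ω} [IsProbabilityMeasure ν]
  {α a₁ b₁ a₂ b₂ : ℝ} {U₁ U₂ D₁ D₂ : ℝ → ℝ}

/-- If tangents to `U₁` cross further to the left, then its best interval is higher. -/
theorem IsBestInterval.le_of_crossing_le (hX : IsDiffuse X ν)
    (hU₁ : IsStrictTangentPair U₁ D₁) (hU₂ : IsStrictTangentPair U₂ D₂)
    (hcross : ∀ a b, 0 ≤ a → a < b → b ≤ 1 → crossing U₁ D₁ a b ≤ crossing U₂ D₂ a b)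
    (hα : 0 ≤ α) (hα1 : α ≤ 1)
    (h₁ : IsBestInterval U₁ D₁ X ν α a₁ b₁) (h₂ : IsBestInterval U₂ D₂ X ν α a₂ b₂) :
    a₂ ≤ a₁ ∧ b₂ ≤ b₁ := by
  rcases h₁.le.eq_or_lt with rfl | hab₁
  · rcases h₂.le.eq_or_lt with rfl | hab₂
    · rw [h₁.eq_mean hU₁ hX, h₂.eq_mean hU₂ hX]
      exact ⟨le_rfl, le_rfl⟩
    · linarith [h₁.le_half_of_degenerate hU₁ hX hα hα1,
        h₂.half_lt_of_nondegenerate hU₂ hX hα hα1 hab₂]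
  rcases h₂.le.eq_or_lt with rfl | hab₂
  · linarith [h₂.le_half_of_degenerate hU₂ hX hα hα1,
      h₁.half_lt_of_nondegenerate hU₁ hX hα hα1 hab₁]
  have hα0 : 0 < α := by linarith [h₁.half_lt_of_nondegenerate hU₁ hX hα hα1 hab₁]
  have ma₁ : a₁ ∈ Icc (0 : ℝ) 1 := ⟨h₁.nonneg, h₁.le.trans h₁.le_one⟩
  have ma₂ : a₂ ∈ Icc (0 : ℝ) 1 := ⟨h₂.nonneg, h₂.le.trans h₂.le_one⟩
  have mb₁ : b₁ ∈ Icc (0 : ℝ) 1 := ⟨h₁.nonneg.trans h₁.le, h₁.le_one⟩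
  have mb₂ : b₂ ∈ Icc (0 : ℝ) 1 := ⟨h₂.nonneg.trans h₂.le, h₂.le_one⟩
  have f₁ := h₁.firstOrder hU₁ hX hα hα1 hab₁
  have f₂ := h₂.firstOrder hU₂ hX hα hα1 hab₂
  have g₁ := h₁.firstOrder_upper hU₁ hX hα hα1 hab₁
  have g₂ := h₂.firstOrder_upper hU₂ hX hα hα1 hab₂
  have ac₁ := hU₁.lt_crossing ma₁ mb₁ hab₁
  have ac₂ := hU₂.lt_crossing ma₂ mb₂ hab₂
  have cb₁ := hU₁.crossing_lt ma₁ mb₁ hab₁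
  have cb₂ := hU₂.crossing_lt ma₂ mb₂ hab₂
  have hc : crossing U₁ D₁ a₁ b₁ ≤ crossing U₂ D₂ a₂ b₂ := by
    by_contra hcon
    have hcon := (not_le.1 hcon).le
    have ha := hX.le_of_firstOrder hα0 hα1 ma₂.1 ma₁.2 ac₂.le hcon f₂ f₁
    -- Reflection reverses the order of the crossings, so the two problems swap roles at the upper
    -- ends.
    have hb := hX.reflect.le_of_firstOrder hα0 hα1 (by linarith [mb₁.2]) (by linarith [mb₂.1])
      (by linarith) (by linarith) g₁ g₂
    have := (hU₁.crossing_mono ma₁ mb₁ ma₂ mb₂ hab₁ hab₂ ha (by linarith)).trans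
      (hcross a₂ b₂ ma₂.1 hab₂ mb₂.2)
    linarith
  have ha := hX.le_of_firstOrder hα0 hα1 ma₁.1 ma₂.2 ac₁.le hc f₁ f₂
  have hb := hX.reflect.le_of_firstOrder hα0 hα1 (by linarith [mb₂.2]) (by linarith [mb₁.1])
    (by linarith) (by linarith) g₂ g₁
  exact ⟨ha, by linarith⟩

end Comparison

/-! ### The law of the posterior -/

section PosteriorLaw

variable {τ : unitInterval → ℝ}

theorem isProbabilityMeasure_posteriorLaw (hτ_pos : ∀ s, 0 < τ s) (hτ_int : ∫ s, τ s = 1) :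
    IsProbabilityMeasure (posteriorLaw τ) := by
  refine ⟨?_⟩
  -- Otherwise the integral would take its default value 0.
  have hi : Integrable τ := by
    by_contra hcon
    rw [integral_undef hcon] at hτ_int
    exact zero_ne_one hτ_int
  rw [posteriorLaw, withDensity_apply _ MeasurableSet.univ, Measure.restrict_univ,
    ← ofReal_integral_eq_lintegral_ofReal hi (.of_forall fun s => (hτ_pos s).le), hτ_int,
    ENNReal.ofReal_one]

theorem isDiffuse_posteriorLaw (hτ_meas : Measurable τ) (hτ_pos : ∀ s, 0 < τ s) :
    IsDiffuse (fun s : unitInterval => (s : ℝ)) (posteriorLaw τ) := by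
  refine ⟨measurable_subtype_coe, fun s => s.2, fun c => ?_, fun x hx y hy hxy => ?_⟩
  · have hac : posteriorLaw τ ≪ volume := withDensity_absolutelyContinuous _ _
    refine hac.ae_le ?_
    by_cases hc : c ∈ Icc (0 : ℝ) 1
    · filter_upwards [compl_mem_ae_iff.2 (measure_singleton (⟨c, hc⟩ : unitInterval))] with s hs h
      exact hs (Subtype.ext h)
    · exact Eventually.of_forall fun s h => hc (h ▸ s.2)
  · have hac : (volume : Measure unitInterval) ≪ posteriorLaw τ :=
      withDensity_absolutelyContinuous' hτ_meas.ennreal_ofReal.aemeasurable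
        (.of_forall fun s => (ENNReal.ofReal_pos.2 (hτ_pos s)).ne')
    have hset : (fun s : unitInterval => (s : ℝ)) ⁻¹' Ioo x y =
        Ioo (⟨x, hx⟩ : unitInterval) ⟨y, hy⟩ := rfl
    rw [pos_iff_ne_zero, hset]
    intro h0
    have := hac h0
    rw [unitInterval.volume_Ioo, ENNReal.ofReal_eq_zero] at this
    change y - x ≤ 0 at this
    linarith

end PosteriorLaw

/-! ### Payoffs of private strategies -/

namespace AgentProblem

section Payoff

variable {A Θ : Type*} [TopologicalSpace A] [MeasurableSpace A] [MeasurableSpace Θ]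
  (P : AgentProblem A Θ)

theorem payoff_eq (κ : PrivateStrategy A Θ) (p s : ℝ) :
    P.payoff κ s = P.payoff κ p + (P.payoff κ 1 - P.payoff κ 0) * (s - p) := by
  simp only [payoff]
  ring

theorem exists_abs_payoff_le : ∃ C : ℝ, ∀ κ : PrivateStrategy A Θ, ∀ s ∈ Icc (0 : ℝ) 1,
    |P.payoff κ s| ≤ C := by
  obtain ⟨C, hC⟩ := P.bounded_u
  refine ⟨C, fun κ s hs => ?_⟩
  have := κ.2
  have hb : ∀ ω, |∫ θ, ∫ a, P.u a ω θ ∂(κ.1 θ) ∂(P.f ω : Measure Θ)| ≤ C := by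
    intro ω
    have h1 : ∀ θ, ‖∫ a, P.u a ω θ ∂(κ.1 θ)‖ ≤ C := fun θ => by
      simpa using norm_integral_le_of_norm_le_const (μ := κ.1 θ) (f := fun a => P.u a ω θ)
        (.of_forall fun a => hC a ω θ)
    simpa using norm_integral_le_of_norm_le_const (μ := (P.f ω : Measure Θ)) (.of_forall h1)
  have h0 := abs_le.1 (hb 0)
  have h1 := abs_le.1 (hb 1)
  rw [payoff, abs_le]
  constructor <;> nlinarith [hs.1, hs.2]

theorem payoff_le_indirectUtility (κ : PrivateStrategy A Θ) {s : ℝ} (hs : s ∈ Icc (0 : ℝ) 1) :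
    P.payoff κ s ≤ P.indirectUtility s := by
  obtain ⟨C, hC⟩ := P.exists_abs_payoff_le
  refine le_ciSup (f := fun κ => P.payoff κ s) ⟨C, ?_⟩ κ
  rintro _ ⟨κ', rfl⟩
  exact (abs_le.1 (hC κ' s hs)).2

variable {P}

theorem IsBayesOptimal.payoff_eq {κ : PrivateStrategy A Θ} {p : ℝ} (h : P.IsBayesOptimal κ p)
    (hp : p ∈ Icc (0 : ℝ) 1) : P.payoff κ p = P.indirectUtility p := by
  have : Nonempty (PrivateStrategy A Θ) := ⟨κ⟩
  exact le_antisymm (P.payoff_le_indirectUtility κ hp) (ciSup_le h)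

variable {D : ℝ → ℝ}

/-- The payoff of a Bayes-optimal strategy lies below the tangent to the indirect utility;
the two may differ when the belief is `0` or `1`. -/
theorem IsBayesOptimal.payoff_le_tangent {κ : PrivateStrategy A Θ} {p s : ℝ}
    (h : P.IsBayesOptimal κ p) (hU : IsStrictTangentPair P.indirectUtility D)
    (hp : p ∈ Icc (0 : ℝ) 1) (hs : s ∈ Icc (0 : ℝ) 1) :
    P.payoff κ s ≤ tangent P.indirectUtility D p s := by
  rw [P.payoff_eq κ p s, h.payoff_eq hp, tangent]
  set k := P.payoff κ 1 - P.payoff κ 0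
  -- The line is below U at t, and the tangent at t is below U at p. Letting t → p from the side of
  -- s compares k with D p on the one side that is needed.
  have key : ∀ t ∈ Icc (0 : ℝ) 1, k * (t - p) ≤ D t * (t - p) := by
    intro t ht
    have h1 := P.payoff_le_indirectUtility κ ht
    rw [P.payoff_eq κ p t, h.payoff_eq hp] at h1
    have h2 := hU.le ht hp
    simp only [tangent] at h2
    linarith
  have hlim := (hU.contD p hp).tendsto
  rcases lt_trichotomy s p with hlt | rfl | hgt
  · have hsub : Ioo s p ⊆ Icc (0 : ℝ) 1 := fun t ht => ⟨hs.1.trans ht.1.le, ht.2.le.trans hp.2⟩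
    have : D p ≤ k := by
      have : (𝓝[Ioo s p] p).NeBot := by
        rw [← mem_closure_iff_nhdsWithin_neBot, closure_Ioo hlt.ne]
        exact ⟨hlt.le, le_rfl⟩
      refine le_of_tendsto (hlim.mono_left (nhdsWithin_mono _ hsub)) ?_
      filter_upwards [self_mem_nhdsWithin] with t ht
      nlinarith [key t (hsub ht), ht.2]
    nlinarith
  · simp
  · have hsub : Ioo p s ⊆ Icc (0 : ℝ) 1 := fun t ht => ⟨hp.1.trans ht.1.le, ht.2.le.trans hs.2⟩
    have : k ≤ D p := by
      have : (𝓝[Ioo p s] p).NeBot := by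
        rw [← mem_closure_iff_nhdsWithin_neBot, closure_Ioo hgt.ne]
        exact ⟨le_rfl, hgt.le⟩
      refine ge_of_tendsto (hlim.mono_left (nhdsWithin_mono _ hsub)) ?_
      filter_upwards [self_mem_nhdsWithin] with t ht
      nlinarith [key t (hsub ht), ht.1]
    nlinarith

theorem exists_tangent_sub_lt_payoff_of_mem_Ioo [Nonempty (PrivateStrategy A Θ)]
    (hU : IsStrictTangentPair P.indirectUtility D)
    {p ε : ℝ} (hp : p ∈ Ioo (0 : ℝ) 1) (hε : 0 < ε) :
    ∃ κ : PrivateStrategy A Θ, ∀ s ∈ Icc (0 : ℝ) 1,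
      tangent P.indirectUtility D p s - ε ≤ P.payoff κ s := by
  have hp' := Ioo_subset_Icc_self hp
  have hlim : Tendsto D (𝓝 p) (𝓝 (D p)) :=
    (hU.contD.continuousAt (Icc_mem_nhds hp.1 hp.2)).tendsto
  have hev := hlim.eventually (Metric.ball_mem_nhds (D p) (by positivity : 0 < ε / 4))
  obtain ⟨t, htball, ht⟩ :=
    ((hev.filter_mono nhdsWithin_le_nhds).and (Ioo_mem_nhdsGT hp.2)).exists
  obtain ⟨r, hrball, hr⟩ :=
    ((hev.filter_mono nhdsWithin_le_nhds).and (Ioo_mem_nhdsLT hp.1)).exists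
  replace htball : |D t - D p| < ε / 4 := htball
  replace hrball : |D r - D p| < ε / 4 := hrball
  have mt : t ∈ Icc (0 : ℝ) 1 := ⟨hp.1.le.trans ht.1.le, ht.2.le⟩
  have mr : r ∈ Icc (0 : ℝ) 1 := ⟨hr.1.le, hr.2.le.trans hp.2.le⟩
  have hpt := sub_pos.2 ht.1
  have hrp := sub_pos.2 hr.2
  -- A payoff loss δ at p costs at most ε / 4 in slope after division by t - p or p - r; another ε /
  -- 4 comes from the variation of D.
  obtain ⟨δ, hδ, hδt, hδr, hδε⟩ : ∃ δ > 0, δ ≤ ε / 4 * (t - p) ∧ δ ≤ ε / 4 * (p - r) ∧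
      δ ≤ ε / 2 :=
    ⟨min (min (ε / 4 * (t - p)) (ε / 4 * (p - r))) (ε / 2), by positivity,
      (min_le_left _ _).trans (min_le_left _ _), (min_le_left _ _).trans (min_le_right _ _),
      min_le_right _ _⟩
  obtain ⟨κ, hκ⟩ := exists_lt_of_lt_ciSup (f := fun κ : PrivateStrategy A Θ => P.payoff κ p)
    (show P.indirectUtility p - δ < _ from sub_lt_self _ hδ)
  have key : ∀ x ∈ Icc (0 : ℝ) 1,
      (P.payoff κ 1 - P.payoff κ 0) * (x - p) ≤ D x * (x - p) + δ := by
    intro x hx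
    have h1 := P.payoff_le_indirectUtility κ hx
    rw [P.payoff_eq κ p x] at h1
    have h2 := hU.le hx hp'
    simp only [tangent] at h2
    linarith
  refine ⟨κ, fun s hs => ?_⟩
  rw [P.payoff_eq κ p s, tangent]
  set k := P.payoff κ 1 - P.payoff κ 0
  have k1 := key t mt
  have k2 := key r mr
  rw [abs_lt] at htball hrball
  have u1 : k ≤ D p + ε / 2 := by
    have : (k - D t - ε / 4) * (t - p) ≤ 0 := by linarith
    have := nonpos_of_mul_nonpos_left this hpt
    linarith
  have u2 : D p - ε / 2 ≤ k := by
    have : (D r - ε / 4 - k) * (p - r) ≤ 0 := by linarith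
    have := nonpos_of_mul_nonpos_left this hrp
    linarith
  have u3 : |(k - D p) * (s - p)| ≤ ε / 2 * 1 := by
    rw [abs_mul]
    refine mul_le_mul (abs_le.2 ⟨by linarith, by linarith⟩) (abs_le.2 ⟨?_, ?_⟩) (abs_nonneg _)
      (by positivity) <;> linarith [hs.1, hs.2, hp'.1, hp'.2]
  have := (abs_le.1 u3).1
  linarith

end Payoff

end AgentProblem

/-- The tangent line varies continuously with the point of contact. -/
theorem IsStrictTangentPair.abs_tangent_sub_le {U D : ℝ → ℝ} {p q s : ℝ} (hs : s ∈ Icc (0 : ℝ) 1) :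
    |tangent U D p s - tangent U D q s| ≤
      |(U p - D p * p) - (U q - D q * q)| + |D p - D q| := by
  have : tangent U D p s - tangent U D q s =
      ((U p - D p * p) - (U q - D q * q)) + (D p - D q) * s := by
    simp only [tangent]
    ring
  rw [this]
  refine (abs_add_le _ _).trans (add_le_add le_rfl ?_)
  rw [abs_mul, abs_of_nonneg hs.1]
  exact mul_le_of_le_one_right (abs_nonneg _) hs.2

theorem IsStrictTangentPair.exists_uniform {U D : ℝ → ℝ} (hU : IsStrictTangentPair U D) {ε : ℝ}
    (hε : 0 < ε) : ∃ δ > 0, ∀ p ∈ Icc (0 : ℝ) 1, ∀ q ∈ Icc (0 : ℝ) 1, |p - q| < δ →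
      ∀ s ∈ Icc (0 : ℝ) 1, |tangent U D p s - tangent U D q s| < ε := by
  have u1 := isCompact_Icc.uniformContinuousOn_of_continuous
    (hU.contU.sub (hU.contD.mul continuousOn_id))
  have u2 := isCompact_Icc.uniformContinuousOn_of_continuous hU.contD
  rw [Metric.uniformContinuousOn_iff] at u1 u2
  obtain ⟨δ₁, hδ₁, h₁⟩ := u1 (ε / 2) (half_pos hε)
  obtain ⟨δ₂, hδ₂, h₂⟩ := u2 (ε / 2) (half_pos hε)
  refine ⟨min δ₁ δ₂, lt_min hδ₁ hδ₂, fun p hp q hq hpq s hs => ?_⟩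
  have e1 := h₁ p hp q hq (hpq.trans_le (min_le_left _ _))
  have e2 := h₂ p hp q hq (hpq.trans_le (min_le_right _ _))
  rw [Real.dist_eq] at e1 e2
  refine (abs_tangent_sub_le hs).trans_lt ?_
  simp only [Pi.sub_apply, Pi.mul_apply, id] at e1
  linarith

/-- At p = 0 or 1 near-optimality controls the slope on one side only, so the strategy is taken from
a nearby interior belief. -/
theorem AgentProblem.exists_tangent_sub_lt_payoff {A Θ : Type*} [TopologicalSpace A]
    [MeasurableSpace A] [MeasurableSpace Θ] {P : AgentProblem A Θ} {D : ℝ → ℝ}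
    [Nonempty (PrivateStrategy A Θ)] (hU : IsStrictTangentPair P.indirectUtility D)
    {p ε : ℝ} (hp : p ∈ Icc (0 : ℝ) 1) (hε : 0 < ε) :
    ∃ κ : PrivateStrategy A Θ, ∀ s ∈ Icc (0 : ℝ) 1,
      tangent P.indirectUtility D p s - ε ≤ P.payoff κ s := by
  obtain ⟨δ, hδ, h⟩ := hU.exists_uniform (half_pos hε)
  have hcl : p ∈ closure (Ioo (0 : ℝ) 1) := by rwa [closure_Ioo zero_ne_one]
  obtain ⟨q, hq, hpq⟩ := Metric.mem_closure_iff.1 hcl δ hδ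
  obtain ⟨κ, hκ⟩ := exists_tangent_sub_lt_payoff_of_mem_Ioo hU hq (half_pos hε)
  refine ⟨κ, fun s hs => ?_⟩
  have h1 := (abs_lt.1 (h p hp q (Ioo_subset_Icc_self hq) hpq s hs)).2
  linarith [hκ s hs]

/-! ### Bounds on the guaranteed payoff -/

namespace AgentProblem

variable {A Θ : Type*} [TopologicalSpace A] [MeasurableSpace A] [MeasurableSpace Θ]
  {P : AgentProblem A Θ} {τ : unitInterval → ℝ} {α : ℝ}

theorem measurable_stateValue (P : AgentProblem A Θ) (σ : Strategy A Θ) (ω : Fin 2) :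
    Measurable fun m => ∫ θ, ∫ a, P.u a ω θ ∂((σ.after m).1 θ) ∂(P.f ω : Measure Θ) := by
  have := σ.2
  have h1 : StronglyMeasurable fun q : (unitInterval × Θ) × A => P.u q.2 ω q.1.2 :=
    ((P.measurable_u ω).comp (measurable_snd.prodMk measurable_fst.snd)).stronglyMeasurable
  have h2 := h1.integral_kernel_prod_right' (κ := σ.1)
  exact (h2.integral_prod_right' (ν := (P.f ω : Measure Θ))).measurable

theorem measurable_payoff_after (P : AgentProblem A Θ) (σ : Strategy A Θ) :
    Measurable fun q : unitInterval × unitInterval => P.payoff (σ.after q.2) (q.1 : ℝ) := by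
  have hs : Measurable fun q : unitInterval × unitInterval => (q.1 : ℝ) :=
    measurable_subtype_coe.comp measurable_fst
  exact ((hs.const_sub 1).mul ((P.measurable_stateValue σ 0).comp measurable_snd)).add
    (hs.mul ((P.measurable_stateValue σ 1).comp measurable_snd))

theorem integrable_payoff_after (P : AgentProblem A Θ) (σ : Strategy A Θ) (s : ℝ)
    (hs : s ∈ Icc (0 : ℝ) 1) (μ : Measure unitInterval) [IsFiniteMeasure μ] :
    Integrable (fun m => P.payoff (σ.after m) s) μ := by
  obtain ⟨C, hC⟩ := P.exists_abs_payoff_le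
  have := (P.measurable_payoff_after σ).comp (measurable_prodMk_left (x := (⟨s, hs⟩ : unitInterval)))
  exact Integrable.of_bound this.aestronglyMeasurable C (.of_forall fun m => hC _ s hs)

theorem integrable_payoff_comp (P : AgentProblem A Θ) (σ : Strategy A Θ)
    {r : unitInterval → unitInterval} (hr : Measurable r) (μ : Measure unitInterval)
    [IsFiniteMeasure μ] :
    Integrable (fun s : unitInterval => P.payoff (σ.after (r s)) (s : ℝ)) μ := by
  obtain ⟨C, hC⟩ := P.exists_abs_payoff_le
  have := (P.measurable_payoff_after σ).comp (measurable_id.prodMk hr)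
  exact Integrable.of_bound this.aestronglyMeasurable C (.of_forall fun s => hC _ s s.2)

theorem integrable_interimPayoff (P : AgentProblem A Θ) (β : AdviserStrategy) (σ : Strategy A Θ)
    (μ : Measure unitInterval) [IsFiniteMeasure μ] :
    Integrable (fun s : unitInterval => ∫ m, P.payoff (σ.after m) (s : ℝ) ∂(β.1 s)) μ := by
  have := β.2
  obtain ⟨C, hC⟩ := P.exists_abs_payoff_le
  have hm := (P.measurable_payoff_after σ).stronglyMeasurable.integral_kernel_prod_right' (κ := β.1)
  refine Integrable.of_bound hm.aestronglyMeasurable C (.of_forall fun s => ?_)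
  simpa using norm_integral_le_of_norm_le_const (μ := β.1 s)
    (f := fun m => P.payoff (σ.after m) (s : ℝ)) (.of_forall fun m => hC (σ.after m) s s.2)

/-- The adviser strategy that reports `r s` at the posterior `s`. -/
def report (r : unitInterval → unitInterval) (hr : Measurable r) : AdviserStrategy :=
  ⟨Kernel.deterministic r hr, inferInstance⟩

theorem expectedPayoff_report (P : AgentProblem A Θ) (σ : Strategy A Θ)
    {r : unitInterval → unitInterval} (hr : Measurable r) :
    P.expectedPayoff τ (report r hr) σ =
      ∫ s, P.payoff (σ.after (r s)) (s : ℝ) ∂(posteriorLaw τ) := by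
  simp only [expectedPayoff, report, Kernel.deterministic_apply, integral_dirac]

theorem expectedPayoff_truthful (P : AgentProblem A Θ) (σ : Strategy A Θ) :
    P.expectedPayoff τ truthful σ = ∫ s, P.payoff (σ.after s) (s : ℝ) ∂(posteriorLaw τ) := by
  simp only [expectedPayoff, truthful, Kernel.id_apply, integral_dirac]

section Finite

variable [IsProbabilityMeasure (posteriorLaw τ)]

theorem integral_le_expectedPayoff (P : AgentProblem A Θ) (β : AdviserStrategy) (σ : Strategy A Θ)
    {h : unitInterval → ℝ} (hi : Integrable h (posteriorLaw τ))
    (hle : ∀ s m, h s ≤ P.payoff (σ.after m) (s : ℝ)) :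
    ∫ s, h s ∂(posteriorLaw τ) ≤ P.expectedPayoff τ β σ := by
  have := β.2
  refine integral_mono hi (P.integrable_interimPayoff β σ _) fun s => ?_
  have := integral_mono (μ := β.1 s) (integrable_const (h s))
    (P.integrable_payoff_after σ s s.2 _) fun m => hle s m
  simpa using this

theorem bddBelow_expectedPayoff (P : AgentProblem A Θ) (σ : Strategy A Θ) :
    BddBelow (range fun β => P.expectedPayoff τ β σ) := by
  obtain ⟨C, hC⟩ := P.exists_abs_payoff_le
  refine ⟨-C, ?_⟩
  rintro _ ⟨β, rfl⟩
  have := P.integral_le_expectedPayoff (τ := τ) β σ (h := fun _ => -C) (integrable_const _)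
    fun s m => (abs_le.1 (hC _ s s.2)).1
  simpa using this

/-- Let each message in `[0,1]` be answered by the strategy that is attached to its cell. -/
def cellStrategy (κ : ℕ → PrivateStrategy A Θ) (i : unitInterval → ℕ) (hi : Measurable i) :
    Strategy A Θ :=
  ⟨⟨fun p => (κ (i p.1)).1 p.2,
    (measurable_from_prod_countable_right (f := fun q : ℕ × Θ => (κ q.1).1 q.2)
      fun n => (κ n).1.measurable).comp ((hi.comp measurable_fst).prodMk measurable_snd)⟩,
    ⟨fun p => (κ (i p.1)).2.isProbabilityMeasure p.2⟩⟩

variable {D : ℝ → ℝ}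

/-- Rounding the projected message down to a fine grid leaves countably many cells, so joint
measurability needs no measurable selection. -/
theorem exists_strategy_approx [Nonempty (PrivateStrategy A Θ)]
    (hU : IsStrictTangentPair P.indirectUtility D) {a b ε : ℝ} (ha : 0 ≤ a) (hab : a ≤ b)
    (hb : b ≤ 1) (hε : 0 < ε) :
    ∃ σ : Strategy A Θ, ∀ m s : unitInterval,
      tangent P.indirectUtility D (max a (min b m)) s - ε ≤ P.payoff (σ.after m) s := by
  obtain ⟨δ, hδ, h⟩ := hU.exists_uniform (half_pos hε)
  obtain ⟨n, hn⟩ := exists_nat_one_div_lt hδ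
  have hn0 : (0 : ℝ) < n + 1 := by positivity
  -- The truncation at 1 only serves to index the grid by all naturals; it is inactive at the cells
  -- that occur.
  have hgrid : ∀ j : ℕ, min ((j : ℝ) / (n + 1)) 1 ∈ Icc (0 : ℝ) 1 := fun j =>
    ⟨le_min (by positivity) zero_le_one, min_le_right _ _⟩
  choose κ hκ using fun j => P.exists_tangent_sub_lt_payoff hU (hgrid j) (half_pos hε)
  have hi : Measurable fun m : unitInterval => ⌊(n + 1) * max a (min b (m : ℝ))⌋₊ :=
    Nat.measurable_floor.comp (by fun_prop)
  refine ⟨cellStrategy κ _ hi, fun m s => ?_⟩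
  refine le_trans ?_ (hκ ⌊(n + 1) * max a (min b (m : ℝ))⌋₊ s s.2)
  set r := max a (min b (m : ℝ))
  have hr : r ∈ Icc (0 : ℝ) 1 :=
    ⟨le_max_of_le_left ha, max_le (hab.trans hb) ((min_le_left _ _).trans hb)⟩
  have f1 := Nat.floor_le (mul_nonneg hn0.le hr.1)
  have f2 := Nat.lt_floor_add_one ((n + 1) * r)
  set j := ⌊(n + 1) * r⌋₊
  have g1 : (j : ℝ) / (n + 1) ≤ r := by rw [div_le_iff₀ hn0]; linarith
  have g2 : r < (j : ℝ) / (n + 1) + 1 / (n + 1) := by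
    rw [← add_div, lt_div_iff₀ hn0]; linarith
  have hj : min ((j : ℝ) / (n + 1)) 1 = (j : ℝ) / (n + 1) := min_eq_left (g1.trans hr.2)
  have := h r hr _ (hgrid j) (by rw [hj, abs_lt]; constructor <;> linarith) s s.2
  linarith [(abs_lt.1 this).2]

theorem exists_objective_sub_le_guarantee [Nonempty (PrivateStrategy A Θ)]
    (hU : IsStrictTangentPair P.indirectUtility D)
    (hX : IsDiffuse (fun s : unitInterval => (s : ℝ)) (posteriorLaw τ)) (hα : 0 ≤ α) (hα1 : α ≤ 1)
    {a b ε : ℝ} (ha : 0 ≤ a) (hab : a ≤ b) (hb : b ≤ 1) (hε : 0 < ε) :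
    ∃ σ : Strategy A Θ, objective P.indirectUtility D (fun s : unitInterval => (s : ℝ))
      (posteriorLaw τ) α a b - ε ≤ P.guarantee τ α σ := by
  obtain ⟨σ, hσ⟩ := exists_strategy_approx hU ha hab hb hε
  refine ⟨σ, ?_⟩
  have ma : a ∈ Icc (0 : ℝ) 1 := ⟨ha, hab.trans hb⟩
  have mb : b ∈ Icc (0 : ℝ) 1 := ⟨ha.trans hab, hb⟩
  have i1 := hX.integrable_comp (hU.continuous_trustedPayoff ma mb)
  have i2 := hX.integrable_min_tangent P.indirectUtility D a b
  have e1 : ∫ s : unitInterval, trustedPayoff P.indirectUtility D a b s ∂(posteriorLaw τ) - ε ≤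
      P.expectedPayoff τ truthful σ := by
    have := integral_mono (i1.sub (integrable_const ε))
      (P.integrable_payoff_comp σ measurable_id (posteriorLaw τ)) fun s => hσ s s
    simp only [Pi.sub_apply] at this
    rw [integral_sub i1 (integrable_const ε)] at this
    rw [expectedPayoff_truthful]
    simpa using this
  have : Nonempty AdviserStrategy := ⟨truthful⟩
  have e2 : ∫ s : unitInterval, min (tangent P.indirectUtility D a s)
      (tangent P.indirectUtility D b s) ∂(posteriorLaw τ) - ε ≤
      ⨅ β : AdviserStrategy, P.expectedPayoff τ β σ := by
    refine le_ciInf fun β => ?_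
    have := P.integral_le_expectedPayoff β σ (i2.sub (integrable_const ε)) fun s m => by
      refine le_trans (sub_le_sub_right (hU.min_tangent_le ma mb
        ⟨le_max_left _ _, max_le hab (min_le_left _ _)⟩) ε) (hσ m s)
    simp only [Pi.sub_apply] at this
    rw [integral_sub i2 (integrable_const ε)] at this
    simpa using this
  have := add_le_add (mul_le_mul_of_nonneg_left e1 hα)
    (mul_le_mul_of_nonneg_left e2 (sub_nonneg.2 hα1))
  rw [guarantee, objective]
  linarith

theorem IsOptimal.objective_le_guarantee {σ : Strategy A Θ} (hσ : P.IsOptimal τ α σ)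
    (hU : IsStrictTangentPair P.indirectUtility D)
    (hX : IsDiffuse (fun s : unitInterval => (s : ℝ)) (posteriorLaw τ)) (hα : 0 ≤ α) (hα1 : α ≤ 1)
    {a b : ℝ} (ha : 0 ≤ a) (hab : a ≤ b) (hb : b ≤ 1) :
    objective P.indirectUtility D (fun s : unitInterval => (s : ℝ)) (posteriorLaw τ) α a b ≤
      P.guarantee τ α σ := by
  have : Nonempty (PrivateStrategy A Θ) := ⟨σ.after 0⟩
  refine le_of_forall_pos_le_add fun ε hε => ?_
  obtain ⟨σ', h'⟩ := exists_objective_sub_le_guarantee (P := P) hU hX hα hα1 ha hab hb hε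
  linarith [hσ σ']

theorem IsTrustRegionStrategy.exists_payoff_le_tangent {σ : Strategy A Θ} {T : Set unitInterval}
    (h : P.IsTrustRegionStrategy σ T) (hU : IsStrictTangentPair P.indirectUtility D)
    (m : unitInterval) : ∃ p ∈ T, ∀ s : unitInterval,
      P.payoff (σ.after m) s ≤ tangent P.indirectUtility D p s := by
  by_cases hm : m ∈ T
  · exact ⟨m, hm, fun s => (h.2.1 m hm).payoff_le_tangent hU m.2 s.2⟩
  · obtain ⟨p, hp, -, hopt⟩ := h.2.2 m hm
    exact ⟨p, hp, fun s => hopt.payoff_le_tangent hU p.2 s.2⟩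

/-- The infimum is tested on the adviser who reports whichever of a and b has the lower tangent at
his belief. -/
theorem guarantee_le {σ : Strategy A Θ} {T : Set unitInterval}
    (h : P.IsTrustRegionStrategy σ T) (hU : IsStrictTangentPair P.indirectUtility D)
    (hX : IsDiffuse (fun s : unitInterval => (s : ℝ)) (posteriorLaw τ)) (hα1 : α ≤ 1)
    {a b : unitInterval} (ha : a ∈ T) (hb : b ∈ T) :
    P.guarantee τ α σ ≤ α * ∫ s, P.payoff (σ.after s) (s : ℝ) ∂(posteriorLaw τ) +
      (1 - α) * ∫ s : unitInterval, min (tangent P.indirectUtility D a s)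
        (tangent P.indirectUtility D b s) ∂(posteriorLaw τ) := by
  classical
  rw [guarantee, expectedPayoff_truthful]
  gcongr
  set U := P.indirectUtility
  have hmeas : MeasurableSet {s : unitInterval | tangent U D a s ≤ tangent U D b s} :=
    measurableSet_le ((continuous_tangent U D a).measurable.comp measurable_subtype_coe)
      ((continuous_tangent U D b).measurable.comp measurable_subtype_coe)
  have hr : Measurable fun s : unitInterval =>
      if tangent U D a s ≤ tangent U D b s then a else b :=
    Measurable.ite hmeas measurable_const measurable_const
  refine (ciInf_le (P.bddBelow_expectedPayoff σ) (report _ hr)).trans ?_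
  rw [expectedPayoff_report]
  refine integral_mono (P.integrable_payoff_comp σ hr _) (hX.integrable_min_tangent U D a b)
    fun s => ?_
  dsimp only
  split_ifs with hs
  · rw [min_eq_left hs]
    exact (h.2.1 a ha).payoff_le_tangent hU a.2 s.2
  · rw [min_eq_right (not_le.1 hs).le]
    exact (h.2.1 b hb).payoff_le_tangent hU b.2 s.2

/-- Among the tangents at points of [a, b], the one at the point nearest to s is highest at s. -/
theorem IsTrustRegionStrategy.payoff_after_le {σ : Strategy A Θ} {T : Set unitInterval}
    (h : P.IsTrustRegionStrategy σ T) (hU : IsStrictTangentPair P.indirectUtility D)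
    {a b : unitInterval} (hT : T ⊆ Icc a b) (s : unitInterval) :
    P.payoff (σ.after s) s ≤ trustedPayoff P.indirectUtility D a b s := by
  obtain ⟨p, hpT, hp⟩ := h.exists_payoff_le_tangent hU s
  refine (hp s).trans ?_
  have hap : (a : ℝ) ≤ p := (hT hpT).1
  have hpb : (p : ℝ) ≤ b := (hT hpT).2
  rw [trustedPayoff]
  rcases le_total (s : ℝ) a with hsa | hsa
  · rw [max_eq_left ((min_le_right _ _).trans hsa)]
    exact hU.tangent_anti a.2 p.2 hap hsa
  rcases le_total (s : ℝ) b with hsb | hsb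
  · rw [min_eq_right hsb, max_eq_right hsa]
    have := hU.le p.2 s.2
    simpa [tangent] using this
  · rw [min_eq_left hsb, max_eq_right (hap.trans hpb)]
    exact hU.tangent_mono p.2 b.2 hpb hsb

/-- The ends of an optimal trust region maximize the guaranteed payoff among intervals; and if the
adviser may be aligned, then the trust region is an interval. -/
theorem IsOptimalTrustRegion.exists_isBestInterval {T : Set unitInterval}
    (h : P.IsOptimalTrustRegion τ α T) (hU : IsStrictTangentPair P.indirectUtility D)
    (hX : IsDiffuse (fun s : unitInterval => (s : ℝ)) (posteriorLaw τ)) (hα : 0 ≤ α) (hα1 : α ≤ 1) :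
    ∃ a b : unitInterval, T = Icc a b ∧
      IsBestInterval P.indirectUtility D (fun s : unitInterval => (s : ℝ)) (posteriorLaw τ)
        α a b := by
  obtain ⟨σ, hopt, hσ⟩ := h
  have hne : T.Nonempty := by
    obtain ⟨p, hp, -⟩ := hσ.exists_payoff_le_tangent hU 0
    exact ⟨p, hp⟩
  obtain ⟨a, haT, ha⟩ := hσ.1.exists_isLeast hne
  obtain ⟨b, hbT, hb⟩ := hσ.1.exists_isGreatest hne
  have hsub : T ⊆ Icc a b := fun x hx => ⟨ha hx, hb hx⟩
  have hab : (a : ℝ) ≤ b := ha hbT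
  have iW := P.integrable_payoff_comp σ measurable_id (posteriorLaw τ)
  have iV := hX.integrable_comp (hU.continuous_trustedPayoff a.2 b.2)
  have hWV := fun s : unitInterval => hσ.payoff_after_le hU hsub s
  have hup := guarantee_le hσ hU hX hα1 haT hbT
  have hint := integral_mono iW iV hWV
  simp only [id] at hint
  have hbest : IsBestInterval P.indirectUtility D (fun s : unitInterval => (s : ℝ))
      (posteriorLaw τ) α a b := by
    refine ⟨a.2.1, hab, b.2.2, fun a' b' h1 h2 h3 => ?_⟩
    -- The guarantee of σ lies between the objective of any interval and that of [a, b].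
    refine (hopt.objective_le_guarantee hU hX hα hα1 h1 h2 h3).trans (hup.trans ?_)
    rw [objective]
    gcongr
  refine ⟨a, b, hsub.antisymm fun x hx => ?_, hbest⟩
  by_contra hxT
  have hax : a < x := lt_of_le_of_ne hx.1 fun heq => hxT (heq ▸ haT)
  have hxb : x < b := lt_of_le_of_ne hx.2 fun heq => hxT (heq ▸ hbT)
  have hα0 : 0 < α := by
    linarith [hbest.half_lt_of_nondegenerate hU hX hα hα1 (show (a : ℝ) < b from hax.trans hxb)]
  -- The gap contains an interval [x, y) of beliefs. There truthful reports are answered from other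
  -- points of T, a strict loss against [a, b] that has positive probability.
  have hnhds : Tᶜ ∩ Iio b ∈ 𝓝 x := inter_mem (hσ.1.isClosed.isOpen_compl.mem_nhds hxT)
    (Iio_mem_nhds hxb)
  obtain ⟨y, hxy, hy⟩ := exists_Ico_subset_of_mem_nhds hnhds ⟨b, hxb⟩
  have hlt : ∫ s, P.payoff (σ.after s) (s : ℝ) ∂(posteriorLaw τ) <
      ∫ s : unitInterval, trustedPayoff P.indirectUtility D a b s ∂(posteriorLaw τ) := by
    refine hX.integral_lt_integral iW iV hWV x.2 y.2 hxy fun s hs => ?_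
    have hsT := hy (⟨hs.1.le, hs.2⟩ : s ∈ Ico x y)
    obtain ⟨p, hpT, hp⟩ := hσ.exists_payoff_le_tangent hU s
    have has : (a : ℝ) ≤ s := hax.le.trans hs.1.le
    have hsb : (s : ℝ) ≤ b := hsT.2.le
    refine (hp s).trans_lt ?_
    rw [trustedPayoff, min_eq_right hsb, max_eq_right has]
    have hps : (p : ℝ) ≠ s := fun heq => hsT.1 (Subtype.ext heq ▸ hpT)
    simpa [tangent] using hU.lt p p.2 s s.2 hps
  have hlow := hopt.objective_le_guarantee hU hX hα hα1 a.2.1 hab b.2.2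
  rw [objective] at hlow
  have := mul_lt_mul_of_pos_left hlt hα0
  linarith

end Finite

end AgentProblem

/-! ### The strong set order -/

/-- Intervals with ordered ends are ordered in the strong set order. -/
theorem strongSetGE_Icc {X : Type*} [LinearOrder X] {a₁ b₁ a₂ b₂ : X} (ha : a₂ ≤ a₁)
    (hb : b₂ ≤ b₁) : StrongSetGE (Icc a₁ b₁) (Icc a₂ b₂) := fun _ hx _ hy =>
  ⟨⟨hx.1.trans (le_max_left _ _), max_le hx.2 (hy.2.trans hb)⟩,
    ⟨le_min (ha.trans hx.1) hy.1, (min_le_right _ _).trans hy.2⟩⟩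

end

end BinaryAdvice

theorem mainTheorem6
    {A₁ Θ₁ A₂ Θ₂ : Type*}
    [MetricSpace A₁] [CompactSpace A₁] [MeasurableSpace A₁] [BorelSpace A₁]
    [MetricSpace Θ₁] [CompactSpace Θ₁] [MeasurableSpace Θ₁] [BorelSpace Θ₁]
    [MetricSpace A₂] [CompactSpace A₂] [MeasurableSpace A₂] [BorelSpace A₂]
    [MetricSpace Θ₂] [CompactSpace Θ₂] [MeasurableSpace Θ₂] [BorelSpace Θ₂]
    (P₁ : BinaryAdvice.AgentProblem A₁ Θ₁) (P₂ : BinaryAdvice.AgentProblem A₂ Θ₂)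
    (hconv₁ : StrictConvexOn ℝ (Set.Icc 0 1) P₁.indirectUtility)
    (hconv₂ : StrictConvexOn ℝ (Set.Icc 0 1) P₂.indirectUtility)
    (hdiff₁ : BinaryAdvice.TwiceDifferentiable P₁.indirectUtility)
    (hdiff₂ : BinaryAdvice.TwiceDifferentiable P₂.indirectUtility)
    (τ : unitInterval → ℝ) (hτ_meas : Measurable τ) (hτ_pos : ∀ s, 0 < τ s)
    (hτ_int : ∫ s, τ s = 1)
    (α : ℝ) (hα : α ∈ Set.Icc (0 : ℝ) 1)
    (hsens : BinaryAdvice.LessInfoSensitive P₁.indirectUtility P₂.indirectUtility)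
    (T₁ T₂ : Set unitInterval)
    (hT₁ : P₁.IsOptimalTrustRegion τ α T₁) (hT₂ : P₂.IsOptimalTrustRegion τ α T₂) :
    BinaryAdvice.StrongSetGE T₁ T₂ := by
  have := BinaryAdvice.isProbabilityMeasure_posteriorLaw hτ_pos hτ_int
  have hX := BinaryAdvice.isDiffuse_posteriorLaw hτ_meas hτ_pos
  have hU₁ := BinaryAdvice.isStrictTangentPair_of_strictConvexOn hconv₁ hdiff₁
  have hU₂ := BinaryAdvice.isStrictTangentPair_of_strictConvexOn hconv₂ hdiff₂
  obtain ⟨a₁, b₁, rfl, h₁⟩ := hT₁.exists_isBestInterval hU₁ hX hα.1 hα.2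
  obtain ⟨a₂, b₂, rfl, h₂⟩ := hT₂.exists_isBestInterval hU₂ hX hα.1 hα.2
  obtain ⟨ha, hb⟩ := BinaryAdvice.IsBestInterval.le_of_crossing_le hX hU₁ hU₂
    (fun a b ha hab hb => hsens.crossing_le hdiff₁ hdiff₂ hU₁ hU₂ ha hab hb) hα.1 hα.2 h₁ h₂
  exact BinaryAdvice.strongSetGE_Icc ha hb
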